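/- Let $\partial=\sum_{i\ge0}u_{i+1}\,\partial/\partial u_i$ on $\mathbb{Q}[u_0,u_1,u_2,\dots]$, and let the polynomials $m_d\in\mathbb{Q}[u_0,u_1,\dots]$, $d\ge0$, be defined by requiring that the series $$b(\lambda)=1+\sum_{d\ge0}\frac{(2d+1)!!\,m_d}{\lambda^{d+1}}$$ satisfies $$b\,\partial^2(b)-\tfrac12\,\partial(b)^2-2(\lambda-2u_0)\,b^2=-2\lambda$$ (so $m_0=u_0$, $m_1=\frac12u_0^2+\frac1{12}u_2$, etc.). For each $d\ge1$, the $d$-th member of the normalized Painlevé XXXIV hierarchy $$2^{2d+1}(2d+1)!!\;\partial_X\Bigl(m_d\bigl(\tfrac{Y}{2},\tfrac{Y_X}{2},\tfrac{Y_{XX}}{2},\dots\bigr)\Bigr)-X\,Y_X-2Y=0$$ has a unique formal solution of the form $$Y(X)=\sum_{n\ge0}\frac{y_{d,n}}{X^{(2d+1)n+2}},\qquad y_{d,n}\in\mathbb{C},\quad y_{d,0}=\frac14,$$ and its coefficients satisfy $$y_{d,n}\;\sim\;\frac1\pi\,\frac{((2d+1)n+1)!}{(2d+1)^n\,n!}\qquad(n\to\infty).$$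 -/

import Mathlib

open Filter Asymptotics
open scoped Nat

noncomputable section

namespace PainleveXXXIV

/-- The ring `ℚ[u₀, u₁, u₂, …]` of differential polynomials. -/
abbrev DiffPoly : Type := MvPolynomial ℕ ℚ

/-- The derivation `∂ = ∑ uᵢ₊₁ ∂/∂uᵢ`. -/
def del : Derivation ℚ DiffPoly DiffPoly :=
  MvPolynomial.mkDerivation ℚ fun i => MvPolynomial.X (i + 1)

/-- `∂` applied coefficientwise to a power series in `λ⁻¹`. -/
def delSeries (b : PowerSeries DiffPoly) : PowerSeries DiffPoly :=
  PowerSeries.mk fun k => del (PowerSeries.coeff k b)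

/-- The variable `PowerSeries.X` stands for `λ⁻¹`. The series `b = 1 + O(λ⁻¹)` satisfies
`b ∂²b - (1/2) (∂b)² - 2 (λ - 2u₀) b² = -2λ`; the equation is written after multiplication by
`λ⁻¹`, which makes it an identity of power series in `λ⁻¹`. -/
def IsResolvent (b : PowerSeries DiffPoly) : Prop :=
  PowerSeries.constantCoeff b = 1 ∧
    PowerSeries.X * (b * delSeries (delSeries b)) -
        (1 / 2 : ℚ) • (PowerSeries.X * delSeries b ^ 2) -
        2 * (1 - 2 * (PowerSeries.C (MvPolynomial.X 0) * PowerSeries.X)) * b ^ 2 = -2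

/-- The part of the coefficient of `λ⁻ᵏ⁻¹` in the equation of `IsResolvent` that only involves the
coefficients `β 0, …, β k`, divided by `4`. -/
def resolventStep (k : ℕ) (β : ℕ → DiffPoly) : DiffPoly :=
  (1 / 4 : ℚ) •
    (∑ p ∈ Finset.HasAntidiagonal.antidiagonal k,
        (β p.1 * del (del (β p.2)) - (1 / 2 : ℚ) • (del (β p.1) * del (β p.2)) +
          4 * MvPolynomial.X 0 * (β p.1 * β p.2)) -
      2 * ∑ i ∈ Finset.range k, β (i + 1) * β (k - i))

theorem resolventStep_congr (k : ℕ) (β γ : ℕ → DiffPoly) (h : ∀ i ≤ k, β i = γ i) :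
    resolventStep k β = resolventStep k γ := by
  unfold resolventStep
  congr 2
  · refine Finset.sum_congr rfl fun p hp => ?_
    have hp' := Finset.HasAntidiagonal.mem_antidiagonal.1 hp
    rw [h p.1 (by omega), h p.2 (by omega)]
  · congr 1
    refine Finset.sum_congr rfl fun i hi => ?_
    have hi' := Finset.mem_range.1 hi
    rw [h (i + 1) (by omega), h (k - i) (by omega)]

theorem isResolvent_iff (b : PowerSeries DiffPoly) :
    IsResolvent b ↔ PowerSeries.coeff 0 b = 1 ∧
      ∀ k, PowerSeries.coeff (k + 1) b = resolventStep k fun i => PowerSeries.coeff i b := by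
  unfold IsResolvent
  rw [← PowerSeries.coeff_zero_eq_constantCoeff_apply]
  refine and_congr_right fun h0 => ?_
  have key : ∀ k, PowerSeries.coeff (k + 1)
      (PowerSeries.X * (b * delSeries (delSeries b)) -
        (1 / 2 : ℚ) • (PowerSeries.X * delSeries b ^ 2) -
        2 * (1 - 2 * (PowerSeries.C (MvPolynomial.X 0) * PowerSeries.X)) * b ^ 2) =
      4 * resolventStep k (fun i => PowerSeries.coeff i b) - 4 * PowerSeries.coeff (k + 1) b := by
    intro k
    have e1 : (2 * (1 - 2 * (PowerSeries.C (MvPolynomial.X 0) * PowerSeries.X)) * b ^ 2 :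
        PowerSeries DiffPoly) = PowerSeries.C 2 * (b * b) -
          PowerSeries.C (4 * MvPolynomial.X 0) * (PowerSeries.X * (b * b)) := by
      have : (PowerSeries.C (2 : DiffPoly) : PowerSeries DiffPoly) = 2 := map_ofNat _ 2
      have h4 : (PowerSeries.C (4 : DiffPoly) : PowerSeries DiffPoly) = 4 := map_ofNat _ 4
      rw [map_mul, this, h4]; ring
    have e2 : PowerSeries.coeff (k + 1) (b * b) = 2 * PowerSeries.coeff (k + 1) b +
        ∑ i ∈ Finset.range k, PowerSeries.coeff (i + 1) b * PowerSeries.coeff (k - i) b := by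
      rw [PowerSeries.coeff_mul, Finset.Nat.sum_antidiagonal_eq_sum_range_succ
        (fun i j => PowerSeries.coeff i b * PowerSeries.coeff j b), Finset.sum_range_succ,
        Finset.sum_range_succ']
      simp only [Nat.add_sub_add_right, Nat.sub_zero, Nat.sub_self, h0]
      ring
    have e3 : (4 : DiffPoly) = MvPolynomial.C 4 := (map_ofNat _ 4).symm
    have e4 : ∀ x : DiffPoly, 4 * ((1 / 4 : ℚ) • x) = x := by
      intro x
      rw [e3, MvPolynomial.C_mul', smul_smul]; norm_num
    rw [e1, resolventStep, e4]
    simp only [map_sub, PowerSeries.coeff_C_mul, PowerSeries.coeff_smul, e2, pow_two,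
      PowerSeries.coeff_succ_X_mul, PowerSeries.coeff_mul k, delSeries, PowerSeries.coeff_mk,
      Finset.sum_add_distrib, Finset.sum_sub_distrib, ← Finset.mul_sum, Finset.smul_sum]
    ring
  have h4 : (4 : DiffPoly) ≠ 0 := by norm_num
  have hc : ∀ k, PowerSeries.coeff (k + 1) (-2 : PowerSeries DiffPoly) = 0 := by
    intro k
    have : (-2 : PowerSeries DiffPoly) = PowerSeries.C (-2) := by
      rw [map_neg, map_ofNat]
    rw [this, PowerSeries.coeff_C]; simp
  constructor
  · intro h k
    have := key k
    rw [h, hc, ← mul_sub] at this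
    have := (mul_eq_zero.1 this.symm).resolve_left h4
    exact (sub_eq_zero.1 this).symm
  · intro h
    ext1 n
    cases n with
    | zero =>
      simp [PowerSeries.coeff_zero_eq_constantCoeff_apply,
        ← PowerSeries.coeff_zero_eq_constantCoeff_apply b, h0]
    | succ k => rw [key k, hc, ← h k, sub_self]

/-- The coefficients of the resolvent series, by recursion. -/
def resolventCoeff : ℕ → DiffPoly
  | 0 => 1
  | k + 1 => resolventStep k fun i => if _h : i ≤ k then resolventCoeff i else 0

theorem existsUnique_isResolvent : ∃! b, IsResolvent b := by
  refine ⟨PowerSeries.mk resolventCoeff, (isResolvent_iff _).2 ⟨?_, fun k => ?_⟩, ?_⟩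
  · rw [PowerSeries.coeff_mk, resolventCoeff]
  · rw [PowerSeries.coeff_mk, resolventCoeff]
    refine resolventStep_congr _ _ _ fun i hi => ?_
    simp [hi]
  · intro b hb
    obtain ⟨h0, h⟩ := (isResolvent_iff b).1 hb
    ext1 n
    rw [PowerSeries.coeff_mk]
    induction n using Nat.strong_induction_on with
    | _ n ih =>
      cases n with
      | zero => rw [h0, resolventCoeff]
      | succ k =>
        rw [h k, resolventCoeff]
        refine resolventStep_congr _ _ _ fun i hi => ?_
        simp [hi, ih i (by omega)]

/-- The series `b(λ)`. -/
def resolvent : PowerSeries DiffPoly := existsUnique_isResolvent.choose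

theorem isResolvent_resolvent : IsResolvent resolvent := existsUnique_isResolvent.choose_spec.1

/-- The polynomials `m_d`, where `b(λ) = 1 + ∑ (2d+1)!! m_d / λ^(d+1)`. -/
def m (d : ℕ) : DiffPoly := (1 / ((2 * d + 1)‼ : ℚ)) • PowerSeries.coeff (d + 1) resolvent

/-- Formal Laurent series in `w = X⁻¹` over `ℂ`: the coefficient at `k` is that of `X^(-k)`. -/
abbrev InvSeries : Type := LaurentSeries ℂ

/-- The independent variable `X = w⁻¹`. -/
def varX : InvSeries := HahnSeries.single (-1) 1

/-- The derivation `d/dX = -w² d/dw`. -/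
def dX (f : InvSeries) : InvSeries :=
  -(HahnSeries.single 2 1 * LaurentSeries.derivative ℂ f)

/-- The left-hand side of the `d`-th member of the hierarchy,
`2^(2d+1) (2d+1)!! ∂_X (m_d(Y/2, Y_X/2, Y_XX/2, …)) - X Y_X - 2 Y`. -/
def P34 (d : ℕ) (Y : InvSeries) : InvSeries :=
  (2 ^ (2 * d + 1) * ((2 * d + 1)‼ : ℂ)) •
      dX (MvPolynomial.aeval (fun i => (1 / 2 : ℂ) • dX^[i] Y) (m d)) -
    varX * dX Y - (2 : ℂ) • Y

/-- The series `∑ yₙ X^(-(2d+1)n-2)`. -/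
def ansatz (d : ℕ) (y : ℕ → ℂ) : InvSeries :=
  HahnSeries.ofPowerSeries ℤ ℂ (PowerSeries.mk fun k =>
    if 2 ≤ k ∧ (2 * d + 1) ∣ k - 2 then y ((k - 2) / (2 * d + 1)) else 0)

/-- `y` is the coefficient sequence of a formal solution `∑ yₙ X^(-(2d+1)n-2)`, `y₀ = 1/4`, of the
`d`-th member of the hierarchy. -/
def IsFormalSolution (d : ℕ) (y : ℕ → ℂ) : Prop :=
  y 0 = 1 / 4 ∧ P34 d (ansatz d y) = 0

end PainleveXXXIV

end

/-!
The derivations of `ℚ[u₀, u₁, …]` commuting with `∂` and sending `u₀` to `(2k+1)‼ ∂ m_k` are the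
flows of the KdV hierarchy; they commute. The solution of the hierarchy with initial value
`u = 1 / (8 (1 - x)²)` belongs to the Brézin–Gross–Witten tau function. Its restriction to the
`d`-th time solves, by homogeneity, the `d`-th Painlevé XXXIV equation, so `y_{d,n}` is up to
explicit factors the derivative at the origin of the free energy along the `d`-th flow, `n` times.
A comparison of lowest coefficients shows that there is no other formal solution.

The free energy satisfies the Virasoro constraints. The zeroth one expresses homogeneity, and the
third-order equation for the generating series of the constraints, built from the resolvent `b` and
its derivatives, leads from one constraint to the next. At the origin the constraints become a
cut-and-join recursion for the derivatives of the free energy. Divided by their expected growth,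
these satisfy an averaging property up to a small error, which reduces their limit to that of the
first derivatives. The first derivatives are explicit quotients of factorials, whose limit `2 / π`
is given by the Wallis product.
-/

noncomputable section

namespace PainleveXXXIV

open MvPolynomial (X)
open PowerSeries (coeff constantCoeff)
open Finset.HasAntidiagonal (antidiagonal mem_antidiagonal)

/-! ### Derivations of polynomial and power series rings -/

section MvPolynomialDerivation

variable {σ R B : Type*} [CommRing R] [CommRing B] [Algebra R B]

theorem derivation_comm_add_of_X
    {D E F : Derivation R (MvPolynomial σ R) (MvPolynomial σ R)}
    (h : ∀ i, D (E (X i)) = E (D (X i)) + F (X i)) (a : MvPolynomial σ R) :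
    D (E a) = E (D a) + F a := by
  have hDE : ⁅D, E⁆ = F := MvPolynomial.derivation_ext fun i => by
    rw [Derivation.commutator_apply, h, add_sub_cancel_left]
  rw [← hDE, Derivation.commutator_apply, add_sub_cancel]

theorem derivation_comm_of_X {D E : Derivation R (MvPolynomial σ R) (MvPolynomial σ R)}
    (h : ∀ i, D (E (X i)) = E (D (X i))) (a : MvPolynomial σ R) : D (E a) = E (D a) := by
  simpa using derivation_comm_add_of_X (F := 0) (by simpa using h) a

theorem map_derivation_eq_map_derivation_of_X {Φ : MvPolynomial σ R →ₐ[R] B}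
    {D E : Derivation R (MvPolynomial σ R) (MvPolynomial σ R)}
    (h : ∀ i, Φ (D (X i)) = Φ (E (X i))) (a : MvPolynomial σ R) : Φ (D a) = Φ (E a) := by
  induction a using MvPolynomial.induction_on with
  | C c => simp
  | add p q hp hq => rw [map_add, map_add, map_add, map_add, hp, hq]
  | mul_X p i hp => simp only [Derivation.leibniz, map_add, smul_eq_mul, map_mul, hp, h]

theorem map_derivation_eq_derivation_map_of_X {Φ : MvPolynomial σ R →ₐ[R] B}
    {D : Derivation R (MvPolynomial σ R) (MvPolynomial σ R)} {E : Derivation R B B}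
    (h : ∀ i, Φ (D (X i)) = E (Φ (X i))) (a : MvPolynomial σ R) : Φ (D a) = E (Φ a) := by
  induction a using MvPolynomial.induction_on with
  | C c => simp
  | add p q hp hq => rw [map_add, map_add, map_add, map_add, hp, hq]
  | mul_X p i hp => simp only [Derivation.leibniz, map_add, smul_eq_mul, map_mul, hp, h]

end MvPolynomialDerivation

section SeriesDeriv

variable {S R : Type*} [CommRing S] [CommRing R] [Algebra S R]

/-- The coefficientwise extension of a derivation to power series; for `D = ∂` it is
`delSeries`. -/
def seriesDeriv (D : Derivation S R R) : Derivation S (PowerSeries R) (PowerSeries R) :=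
  Derivation.mk'
    { toFun := fun f => PowerSeries.mk fun n => D (coeff n f)
      map_add' := fun f g => by ext n; simp
      map_smul' := fun c f => by ext n; simp }
    fun f g => by
      ext n
      simp only [LinearMap.coe_mk, AddHom.coe_mk, PowerSeries.coeff_mk, PowerSeries.coeff_mul,
        map_sum, Derivation.leibniz, map_add, smul_eq_mul, Finset.sum_add_distrib]
      congr 1
      rw [← Finset.Nat.sum_antidiagonal_swap]
      rfl

@[simp]
theorem coeff_seriesDeriv (D : Derivation S R R) (f : PowerSeries R) (n : ℕ) :
    coeff n (seriesDeriv D f) = D (coeff n f) :=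
  PowerSeries.coeff_mk n fun n => D (coeff n f)

@[simp]
theorem seriesDeriv_C (D : Derivation S R R) (a : R) :
    seriesDeriv D (PowerSeries.C a) = PowerSeries.C (D a) := by
  ext n
  rw [coeff_seriesDeriv, PowerSeries.coeff_C, PowerSeries.coeff_C]
  split_ifs <;> simp

@[simp]
theorem seriesDeriv_X (D : Derivation S R R) : seriesDeriv D PowerSeries.X = 0 := by
  ext n
  rw [coeff_seriesDeriv, PowerSeries.coeff_X]
  split_ifs <;> simp

@[simp]
theorem seriesDeriv_X_pow (D : Derivation S R R) (k : ℕ) :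
    seriesDeriv D (PowerSeries.X ^ k) = 0 := by
  simp [Derivation.leibniz_pow]

theorem seriesDeriv_derivative (D : Derivation S R R) (f : PowerSeries R) :
    seriesDeriv D (PowerSeries.derivative R f) = PowerSeries.derivative R (seriesDeriv D f) := by
  ext n
  simp [PowerSeries.coeff_derivative, Derivation.leibniz, mul_comm]

theorem map_seriesDeriv {S' R' : Type*} [CommRing S'] [CommRing R'] [Algebra S' R']
    {Φ : R →+* R'} {D : Derivation S R R} {E : Derivation S' R' R'} (h : ∀ a, Φ (D a) = E (Φ a))
    (f : PowerSeries R) :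
    PowerSeries.map Φ (seriesDeriv D f) = seriesDeriv E (PowerSeries.map Φ f) := by
  ext n
  simp only [PowerSeries.coeff_map, coeff_seriesDeriv, h]

theorem seriesDeriv_comm {D E : Derivation S R R} (h : ∀ a, D (E a) = E (D a))
    (f : PowerSeries R) : seriesDeriv D (seriesDeriv E f) = seriesDeriv E (seriesDeriv D f) := by
  ext n
  simp only [coeff_seriesDeriv, h]

end SeriesDeriv

theorem derivation_ofNat {S B : Type*} [CommRing S] [CommRing B] [Algebra S B]
    (D : Derivation S B B) (n : ℕ) [n.AtLeastTwo] : D ofNat(n) = 0 :=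
  D.map_natCast n

/-! ### The resolvent equation in a differential ring -/

section Resolvent

variable {S B : Type*} [CommRing S] [CommRing B] [Algebra S B] (D : Derivation S B B) (z v b : B)

/-- The resolvent equation for `b` with potential `v`, where `z` stands for `λ⁻¹`; it is the
equation of `IsResolvent`, multiplied by `2`. -/
def ResolventEq : Prop :=
  2 * (z * (b * D (D b))) - z * D b ^ 2 - 4 * (1 - 2 * v * z) * b ^ 2 = -4

/-- The third-order operator that annihilates resolvents: `-4` times the Lenard recursion operator
`λ ∂ - (∂³/4 + 2 v ∂ + ∂(v))`, where `z` stands for `λ⁻¹`, multiplied by `z`. -/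
def lenard (f : B) : B :=
  z * D (D (D f)) - 4 * (1 - 2 * v * z) * D f + 4 * z * D v * f

/-- Half the linearization at `b` of the quadratic left-hand side of `ResolventEq`. -/
def linearization (h : B) : B :=
  z * (h * D (D b) + b * D (D h) - D b * D h) - 4 * (1 - 2 * v * z) * (b * h)

variable {D z v b}

section Map

variable {S' B' : Type*} [CommRing S'] [CommRing B'] [Algebra S' B'] {Φ : B →+* B'}
  {E : Derivation S' B' B'}

theorem ResolventEq.map (hb : ResolventEq D z v b) (h : ∀ f, Φ (D f) = E (Φ f)) :
    ResolventEq E (Φ z) (Φ v) (Φ b) := by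
  rw [ResolventEq] at hb ⊢
  simpa only [map_sub, map_neg, map_mul, map_pow, map_ofNat, map_one, h] using congrArg Φ hb

theorem map_lenard (h : ∀ f, Φ (D f) = E (Φ f)) (f : B) :
    Φ (lenard D z v f) = lenard E (Φ z) (Φ v) (Φ f) := by
  simp only [lenard, map_add, map_sub, map_mul, map_ofNat, map_one, h]

end Map

theorem ResolventEq.mul_lenard_eq_zero (hb : ResolventEq D z v b) (hz : D z = 0) :
    2 * b * lenard D z v b = 0 := by
  have h := congrArg D hb
  simp only [map_sub, map_neg, Derivation.leibniz, Derivation.leibniz_pow, hz,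
    derivation_ofNat, smul_eq_mul, nsmul_eq_mul, Derivation.map_one_eq_zero] at h
  rw [lenard]
  push_cast at h
  linear_combination h

theorem ResolventEq.linearization_derivation (hb : ResolventEq D z v b) (δ : Derivation S B B)
    (hcomm : ∀ f, δ (D f) = D (δ f)) (hz : δ z = 0) :
    2 * linearization D z v b (δ b) = -8 * (z * δ v * b ^ 2) := by
  have h := congrArg δ hb
  simp only [map_sub, map_neg, Derivation.leibniz, Derivation.leibniz_pow, hz,
    derivation_ofNat, smul_eq_mul, nsmul_eq_mul, Derivation.map_one_eq_zero, hcomm] at h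
  rw [linearization]
  push_cast at h
  linear_combination h

/-- Variation of constants: the Wronskian with a solution of the inhomogeneous third-order equation
solves the inhomogeneous linearized equation. -/
theorem linearization_wronskian {g r : B} (hb : lenard D z v b = 0) (hg : lenard D z v g = r) :
    linearization D z v b (g * D b - b * D g) = -(b ^ 2 * r) := by
  rw [lenard] at hb hg
  simp only [linearization, map_sub, map_add, Derivation.leibniz, smul_eq_mul]
  linear_combination (b * g) * hb - b ^ 2 * hg

theorem linearization_sub (f g : B) :
    linearization D z v b (f - g) = linearization D z v b f - linearization D z v b g := by
  simp only [linearization, map_sub]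
  ring

theorem linearization_const_mul {c : B} (hc : D c = 0) (f : B) :
    linearization D z v b (c * f) = c * linearization D z v b f := by
  simp only [linearization, Derivation.leibniz, smul_eq_mul, hc, map_add, mul_zero, map_zero]
  ring

/-- For `E = d/dz` the argument on the left is the derivative of `b` with respect to `λ = z⁻¹`. -/
theorem lenard_neg_sq_mul_derivation {E : Derivation S B B} (hDz : D z = 0) (hEz : E z = 1)
    (hEv : E v = 0) (hcomm : ∀ f, E (D f) = D (E f)) (hb : lenard D z v b = 0) :
    lenard D z v (-(z ^ 2 * E b)) = 4 * z * D b := by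
  have h := congrArg E hb
  rw [lenard] at h hb ⊢
  simp only [map_sub, map_add, map_neg, map_zero, Derivation.leibniz, Derivation.leibniz_pow, hDz,
    hEz, hEv, hcomm, derivation_ofNat, smul_eq_mul, nsmul_eq_mul,
    Derivation.map_one_eq_zero] at h ⊢
  linear_combination -z ^ 2 * h + z * hb

/-- In the Virasoro argument `f` generates the first derivatives of the free energy and `s` the
second ones; the left-hand side is then the derivative of the generating series of the Virasoro
expressions. -/
theorem lenard_loop {f s q : B} (hb : ResolventEq D z v b) (hz : D z = 0) (hq : D q = 0)
    (hlb : lenard D z v b = 0) (hlf : lenard D z v f = 4 * z * D b) (hs : D s = q * b) :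
    lenard D z v (q * (f * D b - b * D f) + 2 * (b * s)) = -8 * q := by
  rw [ResolventEq] at hb
  rw [lenard] at hlb hlf ⊢
  have h := congrArg D hlf
  have h' := congrArg D hlb
  simp only [map_sub, map_add, map_zero, Derivation.leibniz, hz, hq,
    derivation_ofNat, smul_eq_mul, hs, Derivation.map_one_eq_zero] at h h' ⊢
  linear_combination (q * f) * h' - q * b * h +
    (2 * s + 2 * q * D f) * hlb - 2 * q * D b * hlf + 2 * q * hb

end Resolvent

section PowerSeriesResolvent

variable {S R : Type*} [CommRing S] [CommRing R] [Algebra S R] (D : Derivation S R R) (a : R)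

/-- The operator `lenard` on power series in `λ⁻¹`, with a potential independent of `λ`. -/
abbrev seriesLenard (f : PowerSeries R) : PowerSeries R :=
  lenard (seriesDeriv D) PowerSeries.X (PowerSeries.C a) f

/-- The operator `linearization` on power series in `λ⁻¹`, with a potential independent of `λ`. -/
abbrev seriesLinearization (b h : PowerSeries R) : PowerSeries R :=
  linearization (seriesDeriv D) PowerSeries.X (PowerSeries.C a) b h

theorem seriesLenard_eq (f : PowerSeries R) :
    seriesLenard D a f =
      PowerSeries.X * (seriesDeriv D (seriesDeriv D (seriesDeriv D f)) +
        PowerSeries.C (8 * a) * seriesDeriv D f + PowerSeries.C (4 * D a) * f) -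
      PowerSeries.C 4 * seriesDeriv D f := by
  simp only [lenard, seriesDeriv_C, map_mul, map_ofNat]
  ring

theorem coeff_zero_seriesLenard (f : PowerSeries R) :
    coeff 0 (seriesLenard D a f) = -(4 * D (coeff 0 f)) := by
  rw [seriesLenard_eq, map_sub, PowerSeries.coeff_zero_X_mul, PowerSeries.coeff_C_mul,
    coeff_seriesDeriv, zero_sub]

theorem coeff_succ_seriesLenard (f : PowerSeries R) (n : ℕ) :
    coeff (n + 1) (seriesLenard D a f) =
      D (D (D (coeff n f))) + 8 * a * D (coeff n f) + 4 * D a * coeff n f -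
        4 * D (coeff (n + 1) f) := by
  rw [seriesLenard_eq, map_sub, PowerSeries.coeff_succ_X_mul]
  simp only [map_add, PowerSeries.coeff_C_mul, coeff_seriesDeriv]

variable {D a}

theorem eq_zero_of_seriesLinearization_eq_zero [NoZeroDivisors R] [CharZero R]
    {b h : PowerSeries R} (hb : constantCoeff b ≠ 0) (hh : seriesLinearization D a b h = 0) :
    h = 0 := by
  by_contra hne
  obtain ⟨n, q, hq, rfl⟩ :
      ∃ n, ∃ q : PowerSeries R, constantCoeff q ≠ 0 ∧ h = PowerSeries.X ^ n * q :=
    ⟨_, _, PowerSeries.constantCoeff_divXPowOrder_eq_zero_iff.not.2 hne,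
      PowerSeries.X_pow_order_mul_divXPowOrder.symm⟩
  have : Nontrivial R := ⟨⟨_, _, hb⟩⟩
  rw [seriesLinearization, linearization_const_mul (seriesDeriv_X_pow D n)] at hh
  have hlin : seriesLinearization D a b q = 0 :=
    (mul_eq_zero.1 hh).resolve_left (pow_ne_zero n PowerSeries.X_ne_zero)
  have h0 : 4 * (constantCoeff b * constantCoeff q) = 0 := by
    simpa [linearization, map_ofNat constantCoeff 4] using congrArg constantCoeff hlin
  exact (mul_ne_zero (OfNat.ofNat_ne_zero 4) (mul_ne_zero hb hq)) h0

end PowerSeriesResolvent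

/-! ### The resolvent and the commuting flows -/

/-- The coefficient of `λ⁻ᵏ` in the resolvent, a multiple of the Gelfand–Dickey polynomial. -/
def beta (k : ℕ) : DiffPoly := coeff k resolvent

theorem beta_zero : beta 0 = 1 := ((isResolvent_iff _).1 isResolvent_resolvent).1

theorem beta_succ (k : ℕ) : beta (k + 1) = resolventStep k beta :=
  ((isResolvent_iff _).1 isResolvent_resolvent).2 k

@[simp]
theorem del_X (i : ℕ) : del (X i) = X (i + 1) :=
  MvPolynomial.mkDerivation_X _ _ _

theorem ofNat_mul_eq_smul {A : Type*} [Semiring A] [Algebra ℚ A] (n : ℕ) [n.AtLeastTwo] (a : A) :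
    ofNat(n) * a = (ofNat(n) : ℚ) • a := by
  rw [Algebra.smul_def, map_ofNat]

theorem beta_one : beta 1 = X 0 := by
  rw [beta_succ, resolventStep]
  simp only [Finset.HasAntidiagonal.antidiagonal_zero, Finset.sum_singleton, beta_zero,
    Derivation.map_one_eq_zero, map_zero, Finset.sum_range_zero, mul_zero, smul_zero, sub_zero,
    zero_add, mul_one]
  rw [ofNat_mul_eq_smul, smul_smul]
  norm_num

theorem resolventEq_resolvent :
    ResolventEq (seriesDeriv del) PowerSeries.X (PowerSeries.C (X 0)) resolvent := by
  have h : PowerSeries.X * (resolvent * seriesDeriv del (seriesDeriv del resolvent)) -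
      (1 / 2 : ℚ) • (PowerSeries.X * seriesDeriv del resolvent ^ 2) -
      2 * (1 - 2 * (PowerSeries.C (X 0) * PowerSeries.X)) * resolvent ^ 2 = -2 :=
    isResolvent_resolvent.2
  have h_two_mul_half (f : PowerSeries DiffPoly) : 2 * ((1 / 2 : ℚ) • f) = f := by
    rw [two_mul, ← add_smul, add_halves, one_smul]
  rw [ResolventEq]
  linear_combination 2 * h + h_two_mul_half (PowerSeries.X * seriesDeriv del resolvent ^ 2)

theorem constantCoeff_resolvent : constantCoeff resolvent = 1 := isResolvent_resolvent.1

theorem resolvent_ne_zero : resolvent ≠ 0 := by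
  intro h
  simpa [h] using constantCoeff_resolvent

theorem two_ne_zero_powerSeries : (2 : PowerSeries DiffPoly) ≠ 0 := by
  intro h
  simpa [map_ofNat constantCoeff 2] using congrArg constantCoeff h

theorem seriesLenard_resolvent : seriesLenard del (X 0) resolvent = 0 := by
  simpa [resolvent_ne_zero, two_ne_zero_powerSeries] using
    resolventEq_resolvent.mul_lenard_eq_zero (seriesDeriv_X del)

theorem del_beta_succ (n : ℕ) :
    4 * del (beta (n + 1)) =
      del (del (del (beta n))) + 8 * X 0 * del (beta n) + 4 * X 1 * beta n := by
  have h := coeff_succ_seriesLenard del (X 0) resolvent n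
  rw [seriesLenard_resolvent, map_zero, del_X] at h
  simp only [beta]
  linear_combination h

/-- The polynomial part of `λᵏ b(λ)`, multiplied by `λ⁻ᵏ`. -/
def truncResolvent (k : ℕ) : PowerSeries DiffPoly :=
  PowerSeries.mk fun i => if i ≤ k then beta i else 0

theorem seriesLenard_truncResolvent (k : ℕ) :
    seriesLenard del (X 0) (truncResolvent k) =
      PowerSeries.C (4 * del (beta (k + 1))) * PowerSeries.X ^ (k + 1) := by
  ext1 n
  rw [PowerSeries.coeff_C_mul, PowerSeries.coeff_X_pow]
  cases n with
  | zero => simp [coeff_zero_seriesLenard, truncResolvent, beta_zero]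
  | succ n =>
    rw [coeff_succ_seriesLenard, del_X]
    simp only [truncResolvent, PowerSeries.coeff_mk]
    rcases lt_trichotomy n k with h | rfl | h
    · rw [if_pos h.le, if_pos (by omega), if_neg (by omega), del_beta_succ]
      ring
    · rw [if_pos le_rfl, if_neg (by omega), if_pos rfl, del_beta_succ]
      simp
    · rw [if_neg (by omega), if_neg (by omega), if_neg (by omega)]
      simp

/-- The `k`-th flow of the KdV hierarchy: the derivation commuting with `∂` that sends `u₀` to
`∂ β_{k+1}`. -/
def flow (k : ℕ) : Derivation ℚ DiffPoly DiffPoly :=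
  MvPolynomial.mkDerivation ℚ fun i => del^[i] (del (beta (k + 1)))

@[simp]
theorem flow_X (k i : ℕ) : flow k (X i) = del^[i] (del (beta (k + 1))) :=
  MvPolynomial.mkDerivation_X _ _ _

theorem flow_X_zero (k : ℕ) : flow k (X 0) = del (beta (k + 1)) := flow_X k 0

theorem iterate_del_X (i j : ℕ) : del^[i] (X j) = X (j + i) := by
  induction i with
  | zero => rfl
  | succ i ih => rw [Function.iterate_succ_apply', ih, del_X, add_assoc]

theorem flow_zero : flow 0 = del :=
  MvPolynomial.derivation_ext fun i => by
    rw [flow_X, del_X, zero_add, beta_one, del_X, iterate_del_X, add_comm]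

theorem flow_del (k : ℕ) (a : DiffPoly) : flow k (del a) = del (flow k a) :=
  derivation_comm_of_X
    (fun i => by rw [del_X, flow_X, flow_X, Function.iterate_succ_apply']) a

theorem flow_iterate_del (k i : ℕ) (a : DiffPoly) : flow k (del^[i] a) = del^[i] (flow k a) :=
  Function.Semiconj.iterate_right (flow_del k) i a

/-- Both sides solve the same inhomogeneous linearized equation, whose solution is unique. -/
theorem flow_resolvent (k : ℕ) :
    PowerSeries.X ^ k * seriesDeriv (flow k) resolvent =
      truncResolvent k * seriesDeriv del resolvent -
        resolvent * seriesDeriv del (truncResolvent k) := by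
  have h_flow := resolventEq_resolvent.linearization_derivation (seriesDeriv (flow k))
    (seriesDeriv_comm (flow_del k)) (seriesDeriv_X _)
  rw [seriesDeriv_C, flow_X_zero] at h_flow
  have h_wronskian := linearization_wronskian seriesLenard_resolvent (seriesLenard_truncResolvent k)
  refine sub_eq_zero.1 (eq_zero_of_seriesLinearization_eq_zero (D := del) (a := X 0)
    (b := resolvent) (by simp [constantCoeff_resolvent])
    ((mul_eq_zero.1 ?_).resolve_left two_ne_zero_powerSeries))
  rw [seriesLinearization, linearization_sub, linearization_const_mul (seriesDeriv_X_pow del k),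
    h_wronskian, map_mul, map_ofNat]
  linear_combination PowerSeries.X ^ k * h_flow

/-- The Wronskian of two coefficients of the resolvent. -/
def betaWronskian (p : ℕ × ℕ) : DiffPoly :=
  beta p.1 * del (beta p.2) - beta p.2 * del (beta p.1)

theorem betaWronskian_swap (p : ℕ × ℕ) : betaWronskian p.swap = -betaWronskian p := by
  simp [betaWronskian]

theorem sum_betaWronskian (n : ℕ) : ∑ p ∈ antidiagonal n, betaWronskian p = 0 := by
  refine self_eq_neg.1 ?_
  conv_lhs => rw [← Finset.Nat.sum_antidiagonal_swap]
  simp [betaWronskian_swap]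

theorem flow_beta (k l : ℕ) :
    flow k (beta l) = ∑ p ∈ antidiagonal (k + l) with p.1 ≤ k, betaWronskian p := by
  have h := congrArg (coeff (k + l)) (flow_resolvent k)
  rw [add_comm k l, PowerSeries.coeff_X_pow_mul, coeff_seriesDeriv, mul_comm resolvent, map_sub,
    PowerSeries.coeff_mul, PowerSeries.coeff_mul, ← Finset.sum_sub_distrib] at h
  rw [beta, h, add_comm l k, Finset.sum_filter]
  refine Finset.sum_congr rfl fun p _ => ?_
  simp only [coeff_seriesDeriv, truncResolvent, PowerSeries.coeff_mk, betaWronskian]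
  split_ifs
  · simp only [beta]; ring
  · simp

theorem flow_beta_symm (k l : ℕ) : flow k (beta (l + 1)) = flow l (beta (k + 1)) := by
  rw [flow_beta, flow_beta, ← add_assoc, ← add_assoc, add_comm l k, Finset.sum_filter,
    Finset.sum_filter, ← sub_eq_zero]
  conv_lhs => rw [← Finset.Nat.sum_antidiagonal_swap]
  rw [← Finset.sum_sub_distrib, ← neg_eq_zero, ← Finset.sum_neg_distrib]
  refine (Finset.sum_congr rfl fun p hp => ?_).trans (sum_betaWronskian (k + l + 1))
  have hp := mem_antidiagonal.1 hp
  rw [betaWronskian_swap, Prod.fst_swap]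
  by_cases h : p.1 ≤ l
  · rw [if_pos h, if_neg (by omega)]; simp
  · rw [if_neg h, if_pos (by omega)]; simp

theorem flow_comm (k l : ℕ) (a : DiffPoly) : flow k (flow l a) = flow l (flow k a) :=
  derivation_comm_of_X (fun i => by
    rw [flow_X, flow_X, flow_iterate_del, flow_iterate_del, flow_del, flow_del, flow_beta_symm]) a

theorem sum_flow_beta (n : ℕ) :
    ∑ p ∈ antidiagonal n, flow p.1 (beta p.2) =
      -∑ p ∈ antidiagonal n, (p.1 : DiffPoly) * betaWronskian p := by
  have h_card : ∀ q ∈ antidiagonal n,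
      ((antidiagonal n).filter fun p : ℕ × ℕ => q.1 ≤ p.1).card = q.2 + 1 := fun q hq => by
    have hq := mem_antidiagonal.1 hq
    rw [Finset.Nat.antidiagonal_filter_le_fst_of_le (by omega), Finset.card_map,
      Finset.Nat.card_antidiagonal]
    omega
  calc ∑ p ∈ antidiagonal n, flow p.1 (beta p.2)
      = ∑ p ∈ antidiagonal n, ∑ q ∈ antidiagonal n with q.1 ≤ p.1, betaWronskian q :=
        Finset.sum_congr rfl fun p hp => by rw [flow_beta, mem_antidiagonal.1 hp]
    _ = ∑ q ∈ antidiagonal n, ((q.2 : DiffPoly) + 1) * betaWronskian q := by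
        simp only [Finset.sum_filter]
        rw [Finset.sum_comm]
        refine Finset.sum_congr rfl fun q hq => ?_
        rw [← Finset.sum_filter, Finset.sum_const, nsmul_eq_mul, h_card q hq, Nat.cast_succ]
    _ = ∑ q ∈ antidiagonal n, (q.2 : DiffPoly) * betaWronskian q := by
        simp only [add_mul, one_mul, Finset.sum_add_distrib, sum_betaWronskian, add_zero]
    _ = -∑ p ∈ antidiagonal n, (p.1 : DiffPoly) * betaWronskian p := by
        rw [← Finset.Nat.sum_antidiagonal_swap, ← Finset.sum_neg_distrib]
        simp only [betaWronskian_swap, Prod.snd_swap, mul_neg]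

/-! ### Weights and evaluation at the base solution -/

/-- The Euler derivation of the grading in which `uᵢ` has weight `i + 2`. -/
def weightDeriv : Derivation ℚ DiffPoly DiffPoly :=
  MvPolynomial.mkDerivation ℚ fun i => (i + 2 : ℚ) • X i

@[simp]
theorem weightDeriv_X (i : ℕ) : weightDeriv (X i) = (i + 2 : ℚ) • X i :=
  MvPolynomial.mkDerivation_X _ _ _

theorem weightDeriv_del (a : DiffPoly) : weightDeriv (del a) = del (weightDeriv a) + del a :=
  derivation_comm_add_of_X (fun i => by
    rw [del_X, weightDeriv_X, weightDeriv_X, Derivation.map_smul, del_X, Nat.cast_succ,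
      add_right_comm, add_smul _ (1 : ℚ), one_smul]) a

/-- The weighted homogeneous differential polynomials of weight `w`, where `uᵢ` has weight
`i + 2`. -/
def weightSpace (w : ℚ) : Submodule ℚ DiffPoly :=
  Module.End.eigenspace (weightDeriv : DiffPoly →ₗ[ℚ] DiffPoly) w

theorem mem_weightSpace {a : DiffPoly} {w : ℚ} : a ∈ weightSpace w ↔ weightDeriv a = w • a :=
  Module.End.mem_eigenspace_iff

theorem one_mem_weightSpace : 1 ∈ weightSpace 0 := by
  simp [mem_weightSpace]

theorem X_mem_weightSpace (i : ℕ) : X i ∈ weightSpace (i + 2) :=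
  mem_weightSpace.2 (weightDeriv_X i)

theorem mul_mem_weightSpace {a b : DiffPoly} {v w : ℚ} (ha : a ∈ weightSpace v)
    (hb : b ∈ weightSpace w) : a * b ∈ weightSpace (v + w) := by
  rw [mem_weightSpace] at *
  rw [Derivation.leibniz, ha, hb, smul_eq_mul, smul_eq_mul, mul_smul_comm, mul_smul_comm,
    mul_comm b a, ← add_smul, add_comm]

theorem del_mem_weightSpace {a : DiffPoly} {w : ℚ} (ha : a ∈ weightSpace w) :
    del a ∈ weightSpace (w + 1) := by
  rw [mem_weightSpace] at *
  rw [weightDeriv_del, ha, Derivation.map_smul, add_smul, one_smul]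

theorem iterate_del_mem_weightSpace {a : DiffPoly} {w : ℚ} (ha : a ∈ weightSpace w) (i : ℕ) :
    del^[i] a ∈ weightSpace (w + i) := by
  induction i with
  | zero => simpa using ha
  | succ i ih =>
    rw [Function.iterate_succ_apply', Nat.cast_succ, ← add_assoc]
    exact del_mem_weightSpace ih

theorem resolventStep_mem_weightSpace {k : ℕ} {β : ℕ → DiffPoly}
    (hβ : ∀ i ≤ k, β i ∈ weightSpace (2 * i)) :
    resolventStep k β ∈ weightSpace (2 * (k + 1)) := by
  rw [resolventStep, ofNat_mul_eq_smul (A := DiffPoly) 2]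
  refine Submodule.smul_mem _ _ (Submodule.sub_mem _ (Submodule.sum_mem _ fun p hp => ?_)
    (Submodule.smul_mem _ _ (Submodule.sum_mem _ fun i hi => ?_)))
  · have hp := mem_antidiagonal.1 hp
    have h1 := hβ p.1 (by omega)
    have h2 := hβ p.2 (by omega)
    have hk : (k : ℚ) = p.1 + p.2 := by exact_mod_cast hp.symm
    refine Submodule.add_mem _ (Submodule.sub_mem _ ?_ (Submodule.smul_mem _ _ ?_)) ?_
    · convert mul_mem_weightSpace h1 (del_mem_weightSpace (del_mem_weightSpace h2)) using 2
      rw [hk]; ring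
    · convert mul_mem_weightSpace (del_mem_weightSpace h1) (del_mem_weightSpace h2) using 2
      rw [hk]; ring
    · rw [mul_assoc, ofNat_mul_eq_smul (A := DiffPoly)]
      refine Submodule.smul_mem _ _ ?_
      convert mul_mem_weightSpace (X_mem_weightSpace 0) (mul_mem_weightSpace h1 h2) using 2
      rw [hk]; push_cast; ring
  · have hi := Finset.mem_range.1 hi
    convert mul_mem_weightSpace (hβ (i + 1) (by omega)) (hβ (k - i) (by omega)) using 2
    rw [Nat.cast_sub hi.le]
    push_cast; ring

theorem beta_mem_weightSpace (k : ℕ) : beta k ∈ weightSpace (2 * k) := by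
  induction k using Nat.strong_induction_on with
  | _ k ih =>
    cases k with
    | zero => simpa [beta_zero] using one_mem_weightSpace
    | succ k =>
      rw [beta_succ, Nat.cast_succ]
      exact resolventStep_mem_weightSpace fun i hi => ih i (by omega)

theorem weightDeriv_flow (k : ℕ) (a : DiffPoly) :
    weightDeriv (flow k a) = flow k (weightDeriv a) + (2 * k + 1 : ℚ) • flow k a := by
  refine derivation_comm_add_of_X (F := (2 * k + 1 : ℚ) • flow k) (fun i => ?_) a
  have h := mem_weightSpace.1
    (iterate_del_mem_weightSpace (del_mem_weightSpace (beta_mem_weightSpace (k + 1))) i)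
  rw [Derivation.smul_apply, weightDeriv_X, Derivation.map_smul, flow_X, h, ← add_smul]
  push_cast
  congr 1
  ring

theorem flow_mem_weightSpace {a : DiffPoly} {w : ℚ} (ha : a ∈ weightSpace w) (k : ℕ) :
    flow k a ∈ weightSpace (w + (2 * k + 1)) := by
  rw [mem_weightSpace] at *
  rw [weightDeriv_flow, ha, Derivation.map_smul, ← add_smul]

/-- Evaluation of differential polynomials along the base solution `u(x) = 1 / (8 (1 - x)²)` of the
Brézin–Gross–Witten tau function, at `x = 0`: `uᵢ` becomes `u⁽ⁱ⁾(0)`. -/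
def evalBase : DiffPoly →ₐ[ℚ] ℚ := MvPolynomial.aeval fun i => ((i + 1)! : ℚ) / 8

@[simp]
theorem evalBase_X (i : ℕ) : evalBase (X i) = ((i + 1)! : ℚ) / 8 :=
  MvPolynomial.aeval_X _ _

/-- The base solution is homogeneous in `1 - x`. -/
theorem evalBase_del (a : DiffPoly) : evalBase (del a) = evalBase (weightDeriv a) :=
  map_derivation_eq_map_derivation_of_X (fun i => by
    rw [del_X, weightDeriv_X, map_smul, evalBase_X, evalBase_X, Nat.factorial_succ (i + 1),
      smul_eq_mul]
    push_cast
    ring) a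

theorem evalBase_del_of_mem_weightSpace {a : DiffPoly} {w : ℚ} (ha : a ∈ weightSpace w) :
    evalBase (del a) = w * evalBase a := by
  rw [evalBase_del, mem_weightSpace.1 ha, map_smul, smul_eq_mul]

theorem evalBase_beta_succ (k : ℕ) :
    evalBase (beta (k + 1)) = (2 * k + 1) ^ 3 / (8 * (k + 1)) * evalBase (beta k) := by
  have h0 := beta_mem_weightSpace k
  have h1 := del_mem_weightSpace h0
  have h := congrArg evalBase (del_beta_succ k)
  simp only [map_mul, map_add, map_ofNat, evalBase_X, evalBase_del_of_mem_weightSpace h0,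
    evalBase_del_of_mem_weightSpace (beta_mem_weightSpace (k + 1)),
    evalBase_del_of_mem_weightSpace h1,
    evalBase_del_of_mem_weightSpace (del_mem_weightSpace h1)] at h
  norm_num [Nat.factorial] at h
  field_simp
  linear_combination h

/-! ### Iterated commuting derivations and the numbers of the tau function -/

section IterDeriv

variable {ι R A : Type*} [CommRing R] [CommRing A] [Algebra R A] {D : ι → Derivation R A A}
  (hD : ∀ k l a, D k (D l a) = D l (D k a))

/-- The composite of the commuting derivations `D k`, `k ∈ S`. -/
def iterDeriv (S : Multiset ι) : A →ₗ[R] A :=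
  haveI : LeftCommutative fun (k : ι) (L : A →ₗ[R] A) => (D k : A →ₗ[R] A) ∘ₗ L :=
    ⟨fun k l L => LinearMap.ext fun a => hD k l (L a)⟩
  S.foldr (fun k L => (D k : A →ₗ[R] A) ∘ₗ L) LinearMap.id

@[simp]
theorem iterDeriv_zero (a : A) : iterDeriv hD 0 a = a := rfl

@[simp]
theorem iterDeriv_cons (k : ι) (S : Multiset ι) (a : A) :
    iterDeriv hD (k ::ₘ S) a = D k (iterDeriv hD S a) := by
  rw [iterDeriv, Multiset.foldr_cons]
  rfl

theorem iterDeriv_apply (k : ι) (S : Multiset ι) (a : A) :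
    iterDeriv hD S (D k a) = D k (iterDeriv hD S a) := by
  induction S using Multiset.induction_on with
  | empty => rfl
  | cons l S ih => rw [iterDeriv_cons, iterDeriv_cons, ih, hD]

theorem iterDeriv_mul (S : Multiset ι) (a b : A) :
    iterDeriv hD S (a * b) =
      (S.antidiagonal.map fun p => iterDeriv hD p.1 a * iterDeriv hD p.2 b).sum := by
  induction S using Multiset.induction_on with
  | empty => simp
  | cons l S ih =>
    rw [iterDeriv_cons, ih, map_multiset_sum, Multiset.map_map, Multiset.antidiagonal_cons,
      Multiset.map_add, Multiset.sum_add, Multiset.map_map, Multiset.map_map,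
      ← Multiset.sum_map_add]
    refine congrArg Multiset.sum (Multiset.map_congr rfl fun p _ => ?_)
    simp only [Function.comp_apply, Derivation.leibniz, smul_eq_mul, Prod.map_fst, Prod.map_snd,
      iterDeriv_cons, id]
    ring

end IterDeriv

/-- The weight `∑ (2k + 1)` of the composite of the flows indexed by a multiset. -/
def flowWeight (S : Multiset ℕ) : ℕ := (S.map fun k => 2 * k + 1).sum

@[simp]
theorem flowWeight_zero : flowWeight 0 = 0 := rfl

@[simp]
theorem flowWeight_cons (k : ℕ) (S : Multiset ℕ) :
    flowWeight (k ::ₘ S) = 2 * k + 1 + flowWeight S := by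
  simp [flowWeight]

theorem flowWeight_eq (S : Multiset ℕ) : flowWeight S = 2 * S.sum + S.card := by
  rw [flowWeight, Multiset.sum_map_add, Multiset.sum_map_mul_left]
  simp

theorem flowWeight_add (S T : Multiset ℕ) : flowWeight (S + T) = flowWeight S + flowWeight T := by
  simp [flowWeight]

/-- The composite of the KdV flows indexed by `S`. -/
abbrev flows (S : Multiset ℕ) : DiffPoly →ₗ[ℚ] DiffPoly := iterDeriv flow_comm S

theorem flows_mem_weightSpace {a : DiffPoly} {w : ℚ} (S : Multiset ℕ) (ha : a ∈ weightSpace w) :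
    flows S a ∈ weightSpace (w + flowWeight S) := by
  induction S using Multiset.induction_on with
  | empty => simpa using ha
  | cons l S ih =>
    rw [iterDeriv_cons]
    convert flow_mem_weightSpace ih l using 2
    rw [flowWeight_cons]
    push_cast
    ring

/-- The derivative at the origin of the Brézin–Gross–Witten free energy along the times in the
nonempty multiset `S`. Since the second `x`-derivative of the free energy is `u₀`, homogeneity turns
the double integration of `u₀` into a division. -/
def bgwNumber (S : Multiset ℕ) : ℚ :=
  evalBase (flows S (X 0)) / (flowWeight S * (flowWeight S + 1))

theorem bgwNumber_zero_cons_cons (k : ℕ) (S : Multiset ℕ) :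
    bgwNumber (0 ::ₘ k ::ₘ S) = evalBase (flows S (beta (k + 1))) := by
  have h_mem : flows S (beta (k + 1)) ∈ weightSpace (2 * k + 2 + flowWeight S) := by
    convert flows_mem_weightSpace S (beta_mem_weightSpace (k + 1)) using 2
    push_cast
    ring
  have h_flows : flows (0 ::ₘ k ::ₘ S) (X 0) = del (del (flows S (beta (k + 1)))) := by
    simp only [flows, iterDeriv_cons]
    rw [← iterDeriv_apply flow_comm k, flow_X_zero, ← flow_zero, iterDeriv_apply]
  rw [bgwNumber, h_flows, evalBase_del_of_mem_weightSpace (del_mem_weightSpace h_mem),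
    evalBase_del_of_mem_weightSpace h_mem, flowWeight_cons, flowWeight_cons,
    div_eq_iff (by positivity)]
  push_cast
  ring

theorem flowWeight_pos {S : Multiset ℕ} (hS : S ≠ 0) : 0 < flowWeight S := by
  obtain ⟨k, hk⟩ := Multiset.exists_mem_of_ne_zero hS
  obtain ⟨T, rfl⟩ := Multiset.exists_cons_of_mem hk
  rw [flowWeight_cons]
  positivity

theorem bgwNumber_zero_cons {S : Multiset ℕ} (hS : S ≠ 0) :
    bgwNumber (0 ::ₘ S) = flowWeight S * bgwNumber S := by
  have h_mem : flows S (X 0) ∈ weightSpace (2 + flowWeight S) := by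
    convert flows_mem_weightSpace S (X_mem_weightSpace 0) using 2
    push_cast
    ring
  have h_pos : (0 : ℚ) < flowWeight S := Nat.cast_pos.2 (flowWeight_pos hS)
  rw [bgwNumber, bgwNumber, flows, iterDeriv_cons, flow_zero,
    evalBase_del_of_mem_weightSpace h_mem, flowWeight_cons]
  push_cast
  field_simp
  ring

theorem bgwNumber_singleton (k : ℕ) : bgwNumber {k} = evalBase (beta (k + 1)) / (2 * k + 1) := by
  have h := bgwNumber_zero_cons_cons k 0
  rw [bgwNumber_zero_cons Multiset.cons_ne_zero, flows, iterDeriv_zero] at h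
  rw [← h, flowWeight_cons, flowWeight_zero, eq_div_iff (by positivity)]
  push_cast
  rw [mul_comm, Multiset.cons_zero, add_zero]

/-! ### The extended ring with times and free energy variables -/

/-- Variables of the extended ring: the jets `uᵢ`, the times `tₖ`, and the derivatives along `S` of
the `k`-th first derivative of the free energy. -/
inductive ExtVar
  | jet (i : ℕ)
  | time (k : ℕ)
  | energy (k : ℕ) (S : Multiset ℕ)

/-- Differential polynomials in which the times and the derivatives of the free energy are also
available; the Virasoro operators live here. -/
abbrev ExtPoly : Type := MvPolynomial ExtVar ℚ

/-- The inclusion of differential polynomials into the extended ring. -/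
def incl : DiffPoly →ₐ[ℚ] ExtPoly := MvPolynomial.rename ExtVar.jet

/-- The KdV flows on the extended ring, `∂/∂tₖ`. -/
def extFlow (k : ℕ) : Derivation ℚ ExtPoly ExtPoly :=
  MvPolynomial.mkDerivation ℚ fun
    | .jet i => incl (flow k (X i))
    | .time j => if j = k then 1 else 0
    | .energy j S => X (.energy j (k ::ₘ S))

/-- The Euler derivation of the extended ring: `tₖ` has weight `-(2 k + 1)`. -/
def extWeight : Derivation ℚ ExtPoly ExtPoly :=
  MvPolynomial.mkDerivation ℚ fun
    | .jet i => (i + 2 : ℚ) • X (.jet i)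
    | .time j => (-(2 * j + 1) : ℚ) • X (.time j)
    | .energy j S => (2 * j + 1 + flowWeight S : ℚ) • X (.energy j S)

/-- Evaluation of the extended ring at the base point. The value `-1` of `t₀` is the dilaton shift:
the base solution is homogeneous in `1 - x`. -/
def extEval : ExtPoly →ₐ[ℚ] ℚ :=
  MvPolynomial.aeval fun
    | .jet i => ((i + 1)! : ℚ) / 8
    | .time j => if j = 0 then -1 else 0
    | .energy j S => bgwNumber (j ::ₘ S)

theorem incl_X (i : ℕ) : incl (X i) = X (.jet i) :=
  MvPolynomial.rename_X _ _

theorem extFlow_jet (k i : ℕ) : extFlow k (X (.jet i)) = incl (flow k (X i)) :=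
  MvPolynomial.mkDerivation_X _ _ _

theorem extFlow_time (k j : ℕ) : extFlow k (X (.time j)) = if j = k then 1 else 0 :=
  MvPolynomial.mkDerivation_X _ _ _

theorem extFlow_energy (k j : ℕ) (S : Multiset ℕ) :
    extFlow k (X (.energy j S)) = X (.energy j (k ::ₘ S)) :=
  MvPolynomial.mkDerivation_X _ _ _

theorem extWeight_jet (i : ℕ) : extWeight (X (.jet i)) = (i + 2 : ℚ) • X (.jet i) :=
  MvPolynomial.mkDerivation_X _ _ _

theorem extWeight_time (j : ℕ) : extWeight (X (.time j)) = (-(2 * j + 1) : ℚ) • X (.time j) :=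
  MvPolynomial.mkDerivation_X _ _ _

theorem extWeight_energy (j : ℕ) (S : Multiset ℕ) :
    extWeight (X (.energy j S)) = (2 * j + 1 + flowWeight S : ℚ) • X (.energy j S) :=
  MvPolynomial.mkDerivation_X _ _ _

theorem extEval_jet (i : ℕ) : extEval (X (.jet i)) = ((i + 1)! : ℚ) / 8 :=
  MvPolynomial.aeval_X _ _

theorem extEval_time (j : ℕ) : extEval (X (.time j)) = if j = 0 then -1 else 0 :=
  MvPolynomial.aeval_X _ _

theorem extEval_energy (j : ℕ) (S : Multiset ℕ) :
    extEval (X (.energy j S)) = bgwNumber (j ::ₘ S) :=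
  MvPolynomial.aeval_X _ _

theorem incl_flow (k : ℕ) (a : DiffPoly) : incl (flow k a) = extFlow k (incl a) :=
  map_derivation_eq_derivation_map_of_X (fun i => by rw [incl_X, extFlow_jet]) a

theorem incl_weightDeriv (a : DiffPoly) : incl (weightDeriv a) = extWeight (incl a) :=
  map_derivation_eq_derivation_map_of_X
    (fun i => by rw [weightDeriv_X, map_smul, incl_X, extWeight_jet]) a

theorem extEval_incl (a : DiffPoly) : extEval (incl a) = evalBase a :=
  DFunLike.congr_fun (MvPolynomial.algHom_ext (f := extEval.comp incl) fun i => by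
    rw [AlgHom.comp_apply, incl_X, extEval_jet, evalBase_X]) a

theorem extFlow_comm (k l : ℕ) (a : ExtPoly) :
    extFlow k (extFlow l a) = extFlow l (extFlow k a) := by
  refine derivation_comm_of_X (fun v => ?_) a
  rcases v with i | j | ⟨j, S⟩
  · rw [extFlow_jet, extFlow_jet, ← incl_flow, ← incl_flow, flow_comm]
  · rw [extFlow_time, extFlow_time]
    split_ifs <;> simp
  · rw [extFlow_energy, extFlow_energy, extFlow_energy, extFlow_energy, Multiset.cons_swap]

theorem extWeight_extFlow (k : ℕ) (a : ExtPoly) :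
    extWeight (extFlow k a) = extFlow k (extWeight a) + (2 * k + 1 : ℚ) • extFlow k a := by
  refine derivation_comm_add_of_X (F := (2 * k + 1 : ℚ) • extFlow k) (fun v => ?_) a
  rw [Derivation.smul_apply]
  rcases v with i | j | ⟨j, S⟩
  · rw [← incl_X, ← incl_weightDeriv, ← incl_flow, ← incl_weightDeriv, ← incl_flow,
      weightDeriv_flow, map_add, map_smul]
  · rw [extWeight_time, Derivation.map_smul, ← add_smul, extFlow_time]
    split_ifs with hj
    · subst hj; simp
    · simp
  · rw [extWeight_energy, Derivation.map_smul, ← add_smul, extFlow_energy, extWeight_energy,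
      flowWeight_cons]
    congr 1
    push_cast
    ring

theorem extEval_extFlow_zero (a : ExtPoly) : extEval (extFlow 0 a) = extEval (extWeight a) := by
  refine map_derivation_eq_map_derivation_of_X (fun v => ?_) a
  rcases v with i | j | ⟨j, S⟩
  · rw [← incl_X, ← incl_weightDeriv, ← incl_flow, extEval_incl, extEval_incl, flow_zero,
      evalBase_del]
  · rw [extFlow_time, extWeight_time, map_smul, extEval_time]
    split_ifs with hj
    · subst hj; simp
    · simp
  · rw [extFlow_energy, extWeight_energy, map_smul, extEval_energy, extEval_energy,
      Multiset.cons_swap, bgwNumber_zero_cons Multiset.cons_ne_zero, flowWeight_cons]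
    push_cast
    rfl

/-- The composite of the extended flows indexed by `S`. -/
abbrev extFlows (S : Multiset ℕ) : ExtPoly →ₗ[ℚ] ExtPoly := iterDeriv extFlow_comm S

theorem extFlows_incl (S : Multiset ℕ) (a : DiffPoly) : extFlows S (incl a) = incl (flows S a) := by
  induction S using Multiset.induction_on with
  | empty => rfl
  | cons k S ih => rw [iterDeriv_cons, iterDeriv_cons, incl_flow, ih]

theorem extFlows_energy (S T : Multiset ℕ) (j : ℕ) :
    extFlows S (X (.energy j T)) = X (.energy j (S + T)) := by
  induction S using Multiset.induction_on with
  | empty => rw [iterDeriv_zero, zero_add]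
  | cons k S ih => rw [Multiset.cons_add, ← extFlow_energy, ← ih, iterDeriv_cons]

theorem extWeight_extFlows {a : ExtPoly} {w : ℚ} (ha : extWeight a = w • a) (S : Multiset ℕ) :
    extWeight (extFlows S a) = (w + flowWeight S) • extFlows S a := by
  induction S using Multiset.induction_on with
  | empty => simpa using ha
  | cons k S ih =>
    rw [iterDeriv_cons, extWeight_extFlow, ih, Derivation.map_smul, ← add_smul, flowWeight_cons]
    congr 1
    push_cast
    ring

/-- The elements of the extended ring all of whose derivatives along the first `K + 1` flows vanish
at the base point, hence that vanish identically as functions of `t₀, …, t_K`. -/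
def flatIdeal (K : ℕ) : Ideal ExtPoly where
  carrier := {a | ∀ S : Multiset ℕ, (∀ k ∈ S, k ≤ K) → extEval (extFlows S a) = 0}
  zero_mem' S _ := by rw [map_zero, map_zero]
  add_mem' {a b} ha hb S hS := by rw [map_add, map_add, ha S hS, hb S hS, add_zero]
  smul_mem' r a ha S hS := by
    rw [smul_eq_mul, extFlows, iterDeriv_mul, map_multiset_sum, Multiset.map_map]
    refine Multiset.sum_eq_zero fun x hx => ?_
    obtain ⟨p, hp, rfl⟩ := Multiset.mem_map.1 hx
    have hpS := Multiset.mem_antidiagonal.1 hp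
    rw [Function.comp_apply, map_mul,
      ha p.2 fun k hk => hS k (hpS ▸ Multiset.mem_add.2 (Or.inr hk)), mul_zero]

theorem extFlow_mem_flatIdeal {K k : ℕ} (hk : k ≤ K) {a : ExtPoly} (ha : a ∈ flatIdeal K) :
    extFlow k a ∈ flatIdeal K := by
  intro S hS
  rw [extFlows, iterDeriv_apply, ← iterDeriv_cons]
  refine ha _ fun j hj => ?_
  rcases Multiset.mem_cons.1 hj with rfl | hj
  exacts [hk, hS j hj]

/-- At the base point the zeroth flow acts by the weight, so it is injective in positive weight. -/
theorem mem_flatIdeal_of_extFlow_zero_mem {K : ℕ} {a : ExtPoly} {w : ℚ} (hw : 0 < w)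
    (ha : extWeight a = w • a) (h : extFlow 0 a ∈ flatIdeal K) : a ∈ flatIdeal K := by
  intro S hS
  have hflow := h S hS
  rw [extFlows, iterDeriv_apply, extEval_extFlow_zero, extWeight_extFlows ha, map_smul] at hflow
  exact (smul_eq_zero.1 hflow).resolve_left (by positivity)

theorem mem_flatIdeal_of_extFlow_extFlow_mem {K : ℕ} {a : ExtPoly} {w : ℚ} (hw : 0 < w)
    (ha : extWeight a = w • a) (h : extFlow 0 (extFlow 0 a) ∈ flatIdeal K) : a ∈ flatIdeal K := by
  refine mem_flatIdeal_of_extFlow_zero_mem hw ha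
    (mem_flatIdeal_of_extFlow_zero_mem (w := w + 1) (by positivity) ?_ h)
  rw [extWeight_extFlow, ha, Derivation.map_smul, ← add_smul]
  norm_num

theorem energy_sub_mem_flatIdeal {K : ℕ} {a : ExtPoly} {j : ℕ} {T : Multiset ℕ}
    (h : ∀ S, extEval (extFlows S a) = bgwNumber (j ::ₘ (S + T))) :
    X (.energy j T) - a ∈ flatIdeal K := by
  intro S _
  rw [map_sub, map_sub, sub_eq_zero, extFlows_energy, extEval_energy, h]

/-! ### The Virasoro constraints -/

/-- The derivative of the resolvent with respect to `λ`. -/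
def resolventLambda : PowerSeries DiffPoly :=
  -(PowerSeries.X ^ 2 * PowerSeries.derivative DiffPoly resolvent)

theorem seriesLenard_resolventLambda :
    seriesLenard del (X 0) resolventLambda = 4 * PowerSeries.X * seriesDeriv del resolvent :=
  lenard_neg_sq_mul_derivation (E := (PowerSeries.derivative DiffPoly).restrictScalars ℚ)
    (seriesDeriv_X _) PowerSeries.derivative_X PowerSeries.derivative_C
    (fun f => (seriesDeriv_derivative del f).symm) seriesLenard_resolvent

theorem coeff_X_mul_derivative {R : Type*} [CommSemiring R] (f : PowerSeries R) (n : ℕ) :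
    coeff n (PowerSeries.X * PowerSeries.derivative R f) = n * coeff n f := by
  cases n with
  | zero => simp
  | succ n =>
    rw [PowerSeries.coeff_succ_X_mul, PowerSeries.coeff_derivative, Nat.cast_succ, mul_comm]

theorem coeff_succ_wronskian_resolventLambda (m : ℕ) :
    coeff (m + 1) (resolventLambda * seriesDeriv del resolvent -
      resolvent * seriesDeriv del resolventLambda) =
      ∑ p ∈ antidiagonal m, flow p.1 (beta p.2) := by
  have h_wronskian : resolventLambda * seriesDeriv del resolvent -
      resolvent * seriesDeriv del resolventLambda = PowerSeries.X *
        (PowerSeries.X * PowerSeries.derivative DiffPoly (seriesDeriv del resolvent) * resolvent -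
          PowerSeries.X * PowerSeries.derivative DiffPoly resolvent *
            seriesDeriv del resolvent) := by
    rw [resolventLambda, map_neg, Derivation.leibniz, seriesDeriv_X_pow, seriesDeriv_derivative]
    simp only [smul_eq_mul]
    ring
  rw [h_wronskian, PowerSeries.coeff_succ_X_mul, map_sub, PowerSeries.coeff_mul,
    PowerSeries.coeff_mul, ← Finset.sum_sub_distrib, sum_flow_beta, ← Finset.sum_neg_distrib]
  refine Finset.sum_congr rfl fun p _ => ?_
  simp only [coeff_X_mul_derivative, coeff_seriesDeriv, betaWronskian, beta]
  ring

/-- The first-order operators `∑ (2 k + 1) tₖ xₖ` with times `t₀, …, t_K`. -/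
def timeSum (K : ℕ) (x : ℕ → ExtPoly) : ExtPoly :=
  ∑ k ∈ Finset.range (K + 1), (2 * k + 1 : ℚ) • (X (.time k) * x k)

/-- The second-order part of the `m`-th Virasoro operator, applied to the exponential of the free
energy. -/
def energyQuadratic : ℕ → ExtPoly
  | 0 => 0
  | m + 1 => ∑ p ∈ antidiagonal m,
      (X (.energy p.1 {p.2}) + X (.energy p.1 0) * X (.energy p.2 0))

/-- Twice the `m`-th Virasoro operator with times `t₀, …, t_K`, applied to the exponential of the
free energy, and divided by that exponential. -/
def virasoro (K m : ℕ) : ExtPoly :=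
  2 * timeSum K (fun k => X (.energy (k + m) 0)) + energyQuadratic m

theorem extFlow_timeSum {K j : ℕ} (hj : j ≤ K) (x : ℕ → ExtPoly) :
    extFlow j (timeSum K x) =
      (2 * j + 1 : ℚ) • x j + timeSum K fun k => extFlow j (x k) := by
  have h_term : ∀ k ∈ Finset.range (K + 1), extFlow j ((2 * k + 1 : ℚ) • (X (.time k) * x k)) =
      (if k = j then (2 * j + 1 : ℚ) • x j else 0) +
        (2 * k + 1 : ℚ) • (X (.time k) * extFlow j (x k)) := by
    intro k _
    rw [Derivation.map_smul, Derivation.leibniz, extFlow_time, smul_add, add_comm]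
    split_ifs with h
    · subst h; simp
    · simp
  rw [timeSum, map_sum, Finset.sum_congr rfl h_term, Finset.sum_add_distrib, Finset.sum_ite_eq',
    if_pos (Finset.mem_range.2 (Nat.lt_succ_of_le hj)), timeSum]

theorem extFlows_timeSum {K : ℕ} (x : ℕ → ExtPoly) (S : Multiset ℕ) (hS : ∀ k ∈ S, k ≤ K) :
    extFlows S (timeSum K x) =
      (S.map fun d : ℕ => (2 * d + 1 : ℚ) • extFlows (S.erase d) (x d)).sum +
        timeSum K fun k => extFlows S (x k) := by
  induction S using Multiset.induction_on with
  | empty => simp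
  | cons j S ih =>
    have hj : j ≤ K := hS j (Multiset.mem_cons_self j S)
    rw [iterDeriv_cons, ih fun k hk => hS k (Multiset.mem_cons_of_mem hk), map_add,
      extFlow_timeSum hj, map_multiset_sum, Multiset.map_map, Multiset.map_cons,
      Multiset.sum_cons, Multiset.erase_cons_head, ← add_assoc, add_comm _ ((2 * j + 1 : ℚ) • _)]
    simp only [← iterDeriv_cons]
    congr 2
    refine congrArg Multiset.sum (Multiset.map_congr rfl fun d hd => ?_)
    have h_erase : (j ::ₘ S).erase d = j ::ₘ S.erase d := by
      rcases eq_or_ne d j with rfl | h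
      · rw [Multiset.erase_cons_head, Multiset.cons_erase hd]
      · exact Multiset.erase_cons_tail S (Ne.symm h)
    rw [Function.comp_apply, Derivation.map_smul, h_erase, iterDeriv_cons]

theorem extFlow_zero_energyQuadratic_succ (m : ℕ) :
    extFlow 0 (energyQuadratic (m + 1)) =
      ∑ p ∈ antidiagonal m, X (.energy p.1 (0 ::ₘ {p.2})) +
        2 * ∑ p ∈ antidiagonal m, X (.energy p.1 {0}) * X (.energy p.2 0) := by
  have h_swap : ∑ p ∈ antidiagonal m, (X (.energy p.2 {0}) * X (.energy p.1 0) : ExtPoly) =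
      ∑ p ∈ antidiagonal m, X (.energy p.1 {0}) * X (.energy p.2 0) := by
    rw [← Finset.Nat.sum_antidiagonal_swap]
    rfl
  have h_term : ∀ p : ℕ × ℕ,
      extFlow 0 (X (.energy p.1 {p.2}) + X (.energy p.1 0) * X (.energy p.2 0)) =
        X (.energy p.1 (0 ::ₘ {p.2})) +
          (X (.energy p.1 {0}) * X (.energy p.2 0) + X (.energy p.2 {0}) * X (.energy p.1 0)) := by
    intro p
    simp only [map_add, Derivation.leibniz, extFlow_energy, smul_eq_mul, Multiset.cons_zero]
    ring
  rw [energyQuadratic, map_sum, Finset.sum_congr rfl fun p _ => h_term p, Finset.sum_add_distrib,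
    Finset.sum_add_distrib, h_swap, two_mul]

section Quotient

variable (K : ℕ)

/-- The projection to the quotient by the ideal of flat elements. -/
abbrev proj : ExtPoly →ₐ[ℚ] ExtPoly ⧸ flatIdeal K := Ideal.Quotient.mkₐ ℚ (flatIdeal K)

variable {K} in
theorem proj_eq_zero_iff {a : ExtPoly} : proj K a = 0 ↔ a ∈ flatIdeal K :=
  Ideal.Quotient.eq_zero_iff_mem

theorem proj_extFlow_zero_eq_zero (a : ExtPoly) (ha : proj K a = 0) : proj K (extFlow 0 a) = 0 :=
  proj_eq_zero_iff.2 (extFlow_mem_flatIdeal (Nat.zero_le K) (proj_eq_zero_iff.1 ha))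

/-- The derivation induced by the zeroth flow on the quotient. -/
def quotDel : Derivation ℚ (ExtPoly ⧸ flatIdeal K) (ExtPoly ⧸ flatIdeal K) :=
  Derivation.liftOfSurjective (Ideal.Quotient.mkₐ_surjective ℚ (flatIdeal K))
    (proj_extFlow_zero_eq_zero K)

theorem quotDel_proj (a : ExtPoly) : quotDel K (proj K a) = proj K (extFlow 0 a) :=
  Derivation.liftOfSurjective_apply (Ideal.Quotient.mkₐ_surjective ℚ (flatIdeal K))
    (proj_extFlow_zero_eq_zero K) a

/-- The image of differential polynomials in the quotient. -/
def quotIncl : DiffPoly →+* ExtPoly ⧸ flatIdeal K := ((proj K).comp incl : DiffPoly →ₐ[ℚ] _)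

theorem quotIncl_apply (a : DiffPoly) : quotIncl K a = proj K (incl a) := rfl

theorem quotIncl_del (a : DiffPoly) : quotIncl K (del a) = quotDel K (quotIncl K a) := by
  rw [quotIncl_apply, quotIncl_apply, quotDel_proj, ← incl_flow, flow_zero]

theorem proj_energy_zero (a : ℕ) : proj K (X (.energy a {0})) = quotIncl K (beta (a + 1)) := by
  rw [quotIncl_apply, ← sub_eq_zero, ← map_sub, proj_eq_zero_iff]
  refine energy_sub_mem_flatIdeal fun S => ?_
  rw [extFlows_incl, extEval_incl, ← bgwNumber_zero_cons_cons, add_comm S, Multiset.singleton_add,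
    Multiset.cons_swap]

theorem proj_energy_zero_cons (a b : ℕ) :
    proj K (X (.energy a (0 ::ₘ {b}))) = quotIncl K (flow a (beta (b + 1))) := by
  rw [quotIncl_apply, ← sub_eq_zero, ← map_sub, proj_eq_zero_iff]
  refine energy_sub_mem_flatIdeal fun S => ?_
  rw [extFlows_incl, extEval_incl, flows, iterDeriv_apply, ← iterDeriv_cons, ← flows,
    ← bgwNumber_zero_cons_cons, add_comm S, Multiset.cons_add, Multiset.singleton_add,
    Multiset.cons_swap a 0, Multiset.cons_swap a b]

/-- The series `λ⁻ᴷ (∑ (2k + 1) tₖ λᵏ + ∑ Fₖ λ⁻ᵏ⁻¹)`, where `Fₖ` is the `k`-th first derivative of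
the free energy. -/
def currentSeries : PowerSeries (ExtPoly ⧸ flatIdeal K) :=
  PowerSeries.mk fun n =>
    if n ≤ K then proj K ((2 * (K - n : ℕ) + 1 : ℚ) • X (.time (K - n)))
    else proj K (X (.energy (n - K - 1) 0))

variable {K} in
theorem coeff_currentSeries_of_le {n : ℕ} (hn : n ≤ K) :
    coeff n (currentSeries K) = proj K ((2 * (K - n : ℕ) + 1 : ℚ) • X (.time (K - n))) := by
  rw [currentSeries, PowerSeries.coeff_mk, if_pos hn]

theorem coeff_currentSeries_add_succ (a : ℕ) :
    coeff (K + a + 1) (currentSeries K) = proj K (X (.energy a 0)) := by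
  rw [currentSeries, PowerSeries.coeff_mk, if_neg (by omega), show K + a + 1 - K - 1 = a by omega]

theorem seriesDeriv_currentSeries :
    seriesDeriv (quotDel K) (currentSeries K) =
      PowerSeries.X ^ K * PowerSeries.map (quotIncl K) resolvent := by
  ext1 n
  rw [coeff_seriesDeriv, PowerSeries.coeff_X_pow_mul']
  rcases le_or_gt n K with h | h
  · rw [coeff_currentSeries_of_le h, quotDel_proj, Derivation.map_smul, extFlow_time]
    rcases h.lt_or_eq with h | rfl
    · rw [if_neg (by omega), if_neg (by omega), smul_zero, map_zero]
    · rw [if_pos (Nat.sub_self n), if_pos le_rfl, Nat.sub_self, PowerSeries.coeff_map, ← beta,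
        beta_zero, map_one]
      simp
  · obtain ⟨a, rfl⟩ := Nat.exists_eq_add_of_lt h
    rw [coeff_currentSeries_add_succ, if_pos h.le, quotDel_proj, extFlow_energy,
      Multiset.cons_zero, proj_energy_zero, PowerSeries.coeff_map, ← beta,
      show K + a + 1 - K = a + 1 by omega]

theorem coeff_resolvent_mul_currentSeries (m : ℕ) :
    coeff (K + m + 1) (PowerSeries.map (quotIncl K) resolvent * currentSeries K) =
      ∑ p ∈ antidiagonal m, quotIncl K (beta p.1) * proj K (X (.energy p.2 0)) +
        proj K (timeSum K fun k => X (.energy (k + m) {0})) := by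
  rw [PowerSeries.coeff_mul, Finset.Nat.sum_antidiagonal_eq_sum_range_succ (fun i j =>
      coeff i (PowerSeries.map (quotIncl K) resolvent) * coeff j (currentSeries K)),
    show (K + m + 1).succ = (m + 1) + (K + 1) by omega, Finset.sum_range_add,
    Finset.Nat.sum_antidiagonal_eq_sum_range_succ (fun i j =>
      quotIncl K (beta i) * proj K (X (.energy j 0))), timeSum, map_sum]
  congr 1 <;> refine Finset.sum_congr rfl fun k hk => ?_ <;> have hk := Finset.mem_range.1 hk
  · rw [PowerSeries.coeff_map, ← beta, show K + m + 1 - k = K + (m - k) + 1 by omega,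
      coeff_currentSeries_add_succ]
  · rw [PowerSeries.coeff_map, ← beta, coeff_currentSeries_of_le (by omega),
      show K - (K + m + 1 - (m + 1 + k)) = k by omega, ← smul_mul_assoc, map_mul, proj_energy_zero,
      mul_comm, show m + 1 + k = k + m + 1 by ring]

/-- The generating series of the derivatives of the Virasoro expressions along the zeroth flow. -/
def loopSeries : PowerSeries (ExtPoly ⧸ flatIdeal K) :=
  PowerSeries.X ^ K *
      (PowerSeries.map (quotIncl K) resolventLambda *
          seriesDeriv (quotDel K) (PowerSeries.map (quotIncl K) resolvent) -
        PowerSeries.map (quotIncl K) resolvent *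
          seriesDeriv (quotDel K) (PowerSeries.map (quotIncl K) resolventLambda)) +
    2 * (PowerSeries.map (quotIncl K) resolvent * currentSeries K)

theorem map_quotIncl_seriesDeriv (f : PowerSeries DiffPoly) :
    PowerSeries.map (quotIncl K) (seriesDeriv del f) =
      seriesDeriv (quotDel K) (PowerSeries.map (quotIncl K) f) :=
  map_seriesDeriv (quotIncl_del K) f

theorem map_quotIncl_seriesLenard (f : PowerSeries DiffPoly) :
    PowerSeries.map (quotIncl K) (seriesLenard del (X 0) f) =
      seriesLenard (quotDel K) (quotIncl K (X 0)) (PowerSeries.map (quotIncl K) f) := by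
  rw [seriesLenard, map_lenard (map_quotIncl_seriesDeriv K), PowerSeries.map_X, PowerSeries.map_C]

theorem seriesLenard_loopSeries :
    seriesLenard (quotDel K) (quotIncl K (X 0)) (loopSeries K) = -8 * PowerSeries.X ^ K := by
  refine lenard_loop ?_ (seriesDeriv_X _) (seriesDeriv_X_pow _ _) ?_ ?_
    (seriesDeriv_currentSeries K)
  · simpa only [PowerSeries.map_X, PowerSeries.map_C] using
      resolventEq_resolvent.map (map_quotIncl_seriesDeriv K)
  · rw [← seriesLenard, ← map_quotIncl_seriesLenard, seriesLenard_resolvent, map_zero]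
  · rw [← seriesLenard, ← map_quotIncl_seriesLenard, seriesLenard_resolventLambda,
      ← map_quotIncl_seriesDeriv, map_mul, map_mul, map_ofNat, PowerSeries.map_X]

theorem coeff_loopSeries (m : ℕ) :
    coeff (K + m + 1) (loopSeries K) =
      ∑ p ∈ antidiagonal m, quotIncl K (flow p.1 (beta p.2)) +
        2 * (∑ p ∈ antidiagonal m, quotIncl K (beta p.1) * proj K (X (.energy p.2 0)) +
          proj K (timeSum K fun k => X (.energy (k + m) {0}))) := by
  rw [loopSeries, map_add, ← map_ofNat PowerSeries.C 2, PowerSeries.coeff_C_mul,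
    coeff_resolvent_mul_currentSeries, ← map_quotIncl_seriesDeriv, ← map_quotIncl_seriesDeriv,
    ← map_mul, ← map_mul, ← map_sub, show K + m + 1 = (m + 1) + K by ring,
    PowerSeries.coeff_X_pow_mul, PowerSeries.coeff_map, coeff_succ_wronskian_resolventLambda,
    map_sum]

theorem proj_extFlow_zero_virasoro (m : ℕ) :
    proj K (extFlow 0 (virasoro K m)) = coeff (K + m + 1) (loopSeries K) := by
  have h_linear : extFlow 0 (2 * timeSum K fun k => X (.energy (k + m) 0)) =
      2 * (X (.energy m 0) + timeSum K fun k => X (.energy (k + m) {0})) := by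
    rw [Derivation.leibniz, derivation_ofNat, extFlow_timeSum (Nat.zero_le K)]
    simp [extFlow_energy]
  rw [coeff_loopSeries, virasoro, map_add, h_linear]
  cases m with
  | zero => simp [energyQuadratic, beta_zero, map_ofNat]
  | succ m =>
    rw [extFlow_zero_energyQuadratic_succ, Finset.Nat.sum_antidiagonal_succ',
      Finset.Nat.sum_antidiagonal_succ, beta_zero, Derivation.map_one_eq_zero]
    simp only [map_add, map_mul, map_sum, map_ofNat, map_zero, map_one, proj_energy_zero,
      proj_energy_zero_cons]
    ring

variable {K} in
theorem extFlow_extFlow_virasoro_succ_mem {m : ℕ} (h : extFlow 0 (virasoro K m) ∈ flatIdeal K) :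
    extFlow 0 (extFlow 0 (virasoro K (m + 1))) ∈ flatIdeal K := by
  have h_coeff := congrArg (coeff (K + m + 1 + 1)) (seriesLenard_loopSeries K)
  have h_const : (-8 : PowerSeries (ExtPoly ⧸ flatIdeal K)) = PowerSeries.C (-8) := by
    rw [map_neg, map_ofNat]
  rw [coeff_succ_seriesLenard, ← proj_extFlow_zero_virasoro, add_assoc K m 1,
    ← proj_extFlow_zero_virasoro, proj_eq_zero_iff.2 h, h_const, PowerSeries.coeff_C_mul,
    PowerSeries.coeff_X_pow, if_neg (by omega), quotDel_proj] at h_coeff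
  simp only [map_zero, mul_zero, add_zero, zero_sub, neg_eq_zero, ofNat_mul_eq_smul,
    smul_eq_zero, OfNat.ofNat_ne_zero, false_or] at h_coeff
  exact proj_eq_zero_iff.1 h_coeff

end Quotient

theorem extEval_timeSum (K : ℕ) (x : ℕ → ExtPoly) : extEval (timeSum K x) = -extEval (x 0) := by
  rw [timeSum, map_sum, Finset.sum_eq_single 0]
  · simp [extEval_time]
  · intro k _ hk
    simp [extEval_time, hk]
  · simp

theorem extEval_extFlows_timeSum {K : ℕ} (m : ℕ) (S : Multiset ℕ) (hS : ∀ k ∈ S, k ≤ K) :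
    extEval (extFlows S (timeSum K fun k => X (.energy (k + m) 0))) =
      (S.map fun d : ℕ => (2 * d + 1 : ℚ) * bgwNumber ((d + m) ::ₘ S.erase d)).sum -
        bgwNumber (m ::ₘ S) := by
  rw [extFlows_timeSum _ S hS, map_add, extEval_timeSum, map_multiset_sum, Multiset.map_map,
    ← sub_eq_add_neg]
  simp only [Function.comp_def, map_smul, extFlows_energy, extEval_energy, add_zero, smul_eq_mul,
    zero_add]

theorem sum_map_mul_bgwNumber_cons_erase (S : Multiset ℕ) :
    (S.map fun d : ℕ => (2 * d + 1 : ℚ) * bgwNumber (d ::ₘ S.erase d)).sum =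
      flowWeight S * bgwNumber S := by
  rw [Multiset.map_congr rfl fun d hd => by rw [Multiset.cons_erase hd],
    Multiset.sum_map_mul_right, flowWeight, Nat.cast_multiset_sum, Multiset.map_map]
  simp

theorem extFlow_virasoro_zero_mem (K : ℕ) : extFlow 0 (virasoro K 0) ∈ flatIdeal K := by
  intro S hS
  have h_eval := extEval_extFlows_timeSum (K := K) 0 (0 ::ₘ S) (Multiset.forall_mem_cons.2
    ⟨Nat.zero_le K, hS⟩)
  simp only [add_zero] at h_eval
  rw [sum_map_mul_bgwNumber_cons_erase, bgwNumber_zero_cons Multiset.cons_ne_zero, sub_self]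
    at h_eval
  rw [extFlows, iterDeriv_apply, ← iterDeriv_cons, virasoro, energyQuadratic, add_zero,
    ofNat_mul_eq_smul, map_smul, map_smul]
  simp only [add_zero, h_eval, smul_zero]

theorem extWeight_timeSum {x : ℕ → ExtPoly} {w : ℚ}
    (hx : ∀ k, extWeight (x k) = (2 * k + 1 + w) • x k) (K : ℕ) :
    extWeight (timeSum K x) = w • timeSum K x := by
  rw [timeSum, map_sum, Finset.smul_sum]
  refine Finset.sum_congr rfl fun k _ => ?_
  rw [Derivation.map_smul, Derivation.leibniz, hx, extWeight_time, smul_eq_mul, smul_eq_mul,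
    mul_smul_comm, mul_smul_comm, mul_comm (x k), ← add_smul, smul_comm]
  congr 2
  ring

theorem extWeight_energyQuadratic (m : ℕ) :
    extWeight (energyQuadratic m) = (2 * m : ℚ) • energyQuadratic m := by
  cases m with
  | zero => simp [energyQuadratic]
  | succ m =>
    rw [energyQuadratic, map_sum, Finset.smul_sum]
    refine Finset.sum_congr rfl fun p hp => ?_
    have hm : (m : ℚ) = p.1 + p.2 := by exact_mod_cast (mem_antidiagonal.1 hp).symm
    rw [map_add, Derivation.leibniz, extWeight_energy, extWeight_energy, extWeight_energy,
      smul_eq_mul, smul_eq_mul, mul_smul_comm, mul_smul_comm, mul_comm (X (ExtVar.energy p.2 0)),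
      ← add_smul, smul_add, flowWeight_zero, ← Multiset.cons_zero, flowWeight_cons, flowWeight_zero]
    push_cast
    rw [hm]
    congr 2 <;> ring

theorem extWeight_virasoro (K m : ℕ) :
    extWeight (virasoro K m) = (2 * m : ℚ) • virasoro K m := by
  rw [virasoro, ofNat_mul_eq_smul, map_add, Derivation.map_smul, extWeight_energyQuadratic,
    extWeight_timeSum (w := 2 * m), smul_add, smul_comm]
  intro k
  rw [extWeight_energy, flowWeight_zero]
  push_cast
  congr 1
  ring

theorem virasoro_succ_mem_of_extFlow_extFlow_mem {K m : ℕ}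
    (h : extFlow 0 (extFlow 0 (virasoro K (m + 1))) ∈ flatIdeal K) :
    virasoro K (m + 1) ∈ flatIdeal K :=
  mem_flatIdeal_of_extFlow_extFlow_mem (w := 2 * (m + 1 : ℕ)) (by positivity)
    (extWeight_virasoro K (m + 1)) h

theorem extFlow_virasoro_mem (K m : ℕ) : extFlow 0 (virasoro K m) ∈ flatIdeal K := by
  induction m with
  | zero => exact extFlow_virasoro_zero_mem K
  | succ m ih =>
    exact extFlow_mem_flatIdeal (Nat.zero_le K)
      (virasoro_succ_mem_of_extFlow_extFlow_mem (extFlow_extFlow_virasoro_succ_mem ih))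

theorem virasoro_succ_mem (K m : ℕ) : virasoro K (m + 1) ∈ flatIdeal K :=
  virasoro_succ_mem_of_extFlow_extFlow_mem
    (extFlow_mem_flatIdeal (Nat.zero_le K) (extFlow_virasoro_mem K (m + 1)))

theorem extEval_extFlows_energyQuadratic_succ (m : ℕ) (S : Multiset ℕ) :
    extEval (extFlows S (energyQuadratic (m + 1))) =
      ∑ q ∈ antidiagonal m, (bgwNumber (q.1 ::ₘ q.2 ::ₘ S) +
        (S.antidiagonal.map fun p => bgwNumber (q.1 ::ₘ p.1) * bgwNumber (q.2 ::ₘ p.2)).sum) := by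
  rw [energyQuadratic, map_sum, map_sum]
  refine Finset.sum_congr rfl fun q _ => ?_
  rw [map_add, map_add, extFlows_energy, extEval_energy, add_comm S, Multiset.singleton_add,
    iterDeriv_mul, map_multiset_sum, Multiset.map_map]
  simp only [Function.comp_def, map_mul, extFlows_energy, extEval_energy, add_zero]

/-- The cut-and-join recursion: the `(m + 1)`-st Virasoro constraint at the base point. -/
theorem bgwNumber_succ_cons (m : ℕ) (S : Multiset ℕ) :
    2 * bgwNumber ((m + 1) ::ₘ S) =
      2 * (S.map fun d : ℕ => (2 * d + 1 : ℚ) * bgwNumber ((d + (m + 1)) ::ₘ S.erase d)).sum +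
      ∑ q ∈ antidiagonal m, (bgwNumber (q.1 ::ₘ q.2 ::ₘ S) +
        (S.antidiagonal.map fun p => bgwNumber (q.1 ::ₘ p.1) * bgwNumber (q.2 ::ₘ p.2)).sum) := by
  have hS : ∀ k ∈ S, k ≤ S.sum := fun k hk => Multiset.single_le_sum (fun _ _ => Nat.zero_le _) k hk
  have h := virasoro_succ_mem S.sum m S hS
  rw [virasoro, ofNat_mul_eq_smul, map_add, map_smul, map_add, map_smul,
    extEval_extFlows_timeSum (m + 1) S hS, extEval_extFlows_energyQuadratic_succ, smul_eq_mul] at h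
  linear_combination -h

/-! ### Sums of reciprocal binomial coefficients -/

theorem choose_mul_choose_le (m n i j : ℕ) :
    m.choose i * n.choose j ≤ (m + n).choose (i + j) := by
  rw [Nat.add_choose_eq]
  exact Finset.single_le_sum (f := fun p : ℕ × ℕ => m.choose p.1 * n.choose p.2)
    (fun _ _ => Nat.zero_le _) (mem_antidiagonal.2 rfl : (i, j) ∈ _)

theorem le_choose_succ {n r : ℕ} (hr : r < n) : n ≤ (n + 1).choose (r + 1) := by
  obtain ⟨k, rfl⟩ := Nat.exists_eq_add_of_lt hr
  have h := choose_mul_choose_le (k + 1) (r + 1) 1 r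
  rw [Nat.choose_one_right, Nat.choose_succ_self_right, add_comm 1 r,
    show k + 1 + (r + 1) = r + k + 1 + 1 by ring] at h
  exact le_trans (by nlinarith) h

theorem sum_inv_choose_sq_le (n : ℕ) :
    ∑ r ∈ Finset.range (n + 1), ((n.choose r : ℝ) ^ 2)⁻¹ ≤ 3 := by
  rcases n with _ | n
  · norm_num
  have h_inner : ∀ r ∈ Finset.range n, (((n + 1).choose (r + 1) : ℝ) ^ 2)⁻¹ ≤ (n : ℝ)⁻¹ := by
    intro r hr
    have hr := Finset.mem_range.1 hr
    have h_pos : 0 < n := r.zero_le.trans_lt hr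
    have h_choose : n ≤ (n + 1).choose (r + 1) ^ 2 :=
      (le_choose_succ hr).trans (Nat.le_self_pow two_ne_zero _)
    gcongr
    exact_mod_cast h_choose
  have h_sum := Finset.sum_le_card_nsmul _ _ _ h_inner
  rw [Finset.card_range, nsmul_eq_mul] at h_sum
  rw [Finset.sum_range_succ, Finset.sum_range_succ']
  simp only [Nat.choose_zero_right, Nat.choose_self, Nat.cast_one, one_pow, inv_one]
  linarith [mul_inv_le_one (a := (n : ℝ))]

theorem sum_antidiagonal_card {α M : Type*} [AddCommMonoid M] (S : Multiset α) (g : ℕ → M) :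
    (S.antidiagonal.map fun p => g p.1.card).sum =
      ∑ r ∈ Finset.range (S.card + 1), S.card.choose r • g r := by
  induction S using Multiset.induction_on generalizing g with
  | empty => simp
  | cons a S ih =>
    rw [Multiset.antidiagonal_cons, Multiset.map_add, Multiset.sum_add, Multiset.map_map,
      Multiset.map_map, Multiset.card_cons, Finset.sum_choose_succ_nsmul (fun i _ => g i), ← ih,
      ← ih fun i => g (i + 1)]
    simp

theorem sum_antidiagonal_inv_choose_card_le {α : Type*} (S : Multiset α) :
    (S.antidiagonal.map fun p => ((S.card.choose p.1.card : ℝ) ^ 3)⁻¹).sum ≤ 3 := by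
  rw [sum_antidiagonal_card S fun r => ((S.card.choose r : ℝ) ^ 3)⁻¹]
  refine (Finset.sum_congr rfl fun r hr => ?_).trans_le (sum_inv_choose_sq_le S.card)
  have h_ne : (S.card.choose r : ℝ) ≠ 0 :=
    Nat.cast_ne_zero.2 (Nat.choose_pos (Finset.mem_range_succ_iff.1 hr)).ne'
  rw [nsmul_eq_mul]
  field_simp

theorem exists_flowWeight_eq {S : Multiset ℕ} (hS : ∀ d ∈ S, 1 ≤ d) :
    ∃ x, flowWeight S = S.card + (S.card + (S.card + x)) := by
  have h_card : S.card ≤ S.sum := by simpa using Multiset.card_nsmul_le_sum hS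
  obtain ⟨x, hx⟩ := Nat.exists_eq_add_of_le h_card
  exact ⟨2 * x, by rw [flowWeight_eq, hx]; ring⟩

theorem choose_card_pow_le {I J : Multiset ℕ} (hI : ∀ d ∈ I, 1 ≤ d) (hJ : ∀ d ∈ J, 1 ≤ d) :
    (I.card + J.card).choose I.card ^ 3 ≤
      (flowWeight I + flowWeight J).choose (flowWeight I) := by
  obtain ⟨x, hx⟩ := exists_flowWeight_eq hI
  obtain ⟨y, hy⟩ := exists_flowWeight_eq hJ
  set i := I.card
  set j := J.card
  have h_add : flowWeight I + flowWeight J = (i + j) + ((i + j) + ((i + j) + (x + y))) := by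
    rw [hx, hy]; ring
  rw [h_add, hx]
  calc (i + j).choose i ^ 3
      = (i + j).choose i * ((i + j).choose i * ((i + j).choose i * 1)) := by ring
    _ ≤ (i + j).choose i * ((i + j).choose i * ((i + j).choose i * (x + y).choose x)) := by
        gcongr
        exact Nat.choose_pos (Nat.le_add_right x y)
    _ ≤ (i + j).choose i * ((i + j).choose i * ((i + j) + (x + y)).choose (i + x)) := by
        gcongr
        exact choose_mul_choose_le _ _ _ _
    _ ≤ (i + j).choose i * ((i + j) + ((i + j) + (x + y))).choose (i + (i + x)) := by
        gcongr
        exact choose_mul_choose_le _ _ _ _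
    _ ≤ _ := choose_mul_choose_le _ _ _ _

theorem choose_sq_mul_choose_card_pow_le {S I J : Multiset ℕ} (hS : ∀ d ∈ S, 1 ≤ d)
    (hIJ : I + J = S) (m a : ℕ) :
    m.choose a ^ 2 * S.card.choose I.card ^ 3 ≤
      (2 * m + flowWeight S).choose (2 * a + flowWeight I) := by
  subst hIJ
  have h_sq : m.choose a ^ 2 ≤ (2 * m).choose (2 * a) := by
    rw [two_mul, two_mul, sq]
    exact choose_mul_choose_le _ _ _ _
  have h_cube := choose_card_pow_le (fun d hd => hS d (Multiset.mem_add.2 (.inl hd)))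
    (fun d hd => hS d (Multiset.mem_add.2 (.inr hd)))
  rw [Multiset.card_add, flowWeight_add]
  exact (Nat.mul_le_mul h_sq h_cube).trans (choose_mul_choose_le _ _ _ _)

theorem sum_antidiagonal_inv_choose_le (m : ℕ) {S : Multiset ℕ} (hS : ∀ d ∈ S, 1 ≤ d) :
    ∑ q ∈ antidiagonal m, (S.antidiagonal.map fun p =>
      ((2 * m + flowWeight S).choose (2 * q.1 + flowWeight p.1) : ℝ)⁻¹).sum ≤ 9 := by
  have h_inner : ∀ q ∈ antidiagonal m, (S.antidiagonal.map fun p =>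
      ((2 * m + flowWeight S).choose (2 * q.1 + flowWeight p.1) : ℝ)⁻¹).sum ≤
      ((m.choose q.1 : ℝ) ^ 2)⁻¹ * 3 := by
    intro q hq
    refine le_trans ?_ (mul_le_mul_of_nonneg_left (sum_antidiagonal_inv_choose_card_le S)
      (by positivity))
    rw [← Multiset.sum_map_mul_left]
    refine Multiset.sum_map_le_sum_map _ _ fun p hp => ?_
    have hp := Multiset.mem_antidiagonal.1 hp
    have hm : 0 < m.choose q.1 := Nat.choose_pos (Nat.le.intro (mem_antidiagonal.1 hq))
    have h_card : 0 < S.card.choose p.1.card :=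
      Nat.choose_pos (Multiset.card_le_card (hp ▸ Multiset.le_add_right p.1 p.2))
    rw [← mul_inv]
    gcongr
    exact_mod_cast choose_sq_mul_choose_card_pow_le hS hp m q.1
  calc _ ≤ ∑ q ∈ antidiagonal m, ((m.choose q.1 : ℝ) ^ 2)⁻¹ * 3 := Finset.sum_le_sum h_inner
    _ = (∑ r ∈ Finset.range (m + 1), ((m.choose r : ℝ) ^ 2)⁻¹) * 3 := by
      rw [← Finset.sum_mul,
        Finset.Nat.sum_antidiagonal_eq_sum_range_succ fun r _ => ((m.choose r : ℝ) ^ 2)⁻¹]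
    _ ≤ 9 := by linarith [sum_inv_choose_sq_le m]

/-! ### Normalized numbers -/

theorem bgwNumber_singleton_zero : bgwNumber {0} = 1 / 8 := by
  rw [bgwNumber_singleton, beta_one]
  simp [evalBase]

theorem bgwNumber_succ_cons_nonneg {m : ℕ} {S : Multiset ℕ}
    (h : ∀ T, flowWeight T < flowWeight ((m + 1) ::ₘ S) → 0 ≤ bgwNumber T) :
    0 ≤ bgwNumber ((m + 1) ::ₘ S) := by
  rw [flowWeight_cons] at h
  have h_merge : 0 ≤ (S.map fun d : ℕ => (2 * d + 1 : ℚ) *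
      bgwNumber ((d + (m + 1)) ::ₘ S.erase d)).sum := by
    refine Multiset.sum_nonneg fun x hx => ?_
    obtain ⟨d, hd, rfl⟩ := Multiset.mem_map.1 hx
    obtain ⟨T, rfl⟩ := Multiset.exists_cons_of_mem hd
    refine mul_nonneg (by positivity) (h _ ?_)
    rw [Multiset.erase_cons_head, flowWeight_cons, flowWeight_cons]
    omega
  have h_split : 0 ≤ ∑ q ∈ antidiagonal m, (bgwNumber (q.1 ::ₘ q.2 ::ₘ S) +
      (S.antidiagonal.map fun p => bgwNumber (q.1 ::ₘ p.1) * bgwNumber (q.2 ::ₘ p.2)).sum) := by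
    refine Finset.sum_nonneg fun q hq => add_nonneg (h _ ?_) (Multiset.sum_nonneg fun x hx => ?_)
    · rw [flowWeight_cons, flowWeight_cons]
      have hq := mem_antidiagonal.1 hq
      omega
    · obtain ⟨p, hp, rfl⟩ := Multiset.mem_map.1 hx
      rw [← Multiset.mem_antidiagonal.1 hp, flowWeight_add] at h
      have hq := mem_antidiagonal.1 hq
      refine mul_nonneg (h _ ?_) (h _ ?_) <;> rw [flowWeight_cons] <;> omega
  linarith [bgwNumber_succ_cons m S]

theorem bgwNumber_nonneg (S : Multiset ℕ) : 0 ≤ bgwNumber S := by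
  induction h : flowWeight S using Nat.strong_induction_on generalizing S with
  | _ N ih =>
    subst h
    rcases S.empty_or_exists_mem with rfl | ⟨k, hk⟩
    · simp [bgwNumber]
    · obtain ⟨R, rfl⟩ := Multiset.exists_cons_of_mem hk
      rcases k with _ | m
      · rcases eq_or_ne R 0 with rfl | hR
        · rw [Multiset.cons_zero, bgwNumber_singleton_zero]
          norm_num
        · rw [bgwNumber_zero_cons hR]
          exact mul_nonneg (Nat.cast_nonneg _) (ih _ (by rw [flowWeight_cons]; omega) R rfl)
      · exact bgwNumber_succ_cons_nonneg fun T hT => ih _ hT T rfl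

/-- The numbers `bgwNumber S`, normalized so that the cut-and-join recursion becomes an averaging
property up to a small error. -/
def normalizedNumber (S : Multiset ℕ) : ℝ :=
  4 ^ (S.sum + 1) * (bgwNumber S : ℝ) / ((flowWeight S - 1)! : ℝ)

theorem normalizedNumber_nonneg (S : Multiset ℕ) : 0 ≤ normalizedNumber S := by
  have h : (0 : ℝ) ≤ bgwNumber S := by exact_mod_cast bgwNumber_nonneg S
  unfold normalizedNumber
  positivity

theorem cast_bgwNumber_eq {S : Multiset ℕ} {s w : ℕ} (hs : S.sum = s) (hw : flowWeight S = w + 1) :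
    (bgwNumber S : ℝ) = w ! / 4 ^ (s + 1) * normalizedNumber S := by
  rw [normalizedNumber, hs, hw, Nat.add_sub_cancel]
  field_simp

theorem normalizedNumber_zero_cons {S : Multiset ℕ} (hS : S ≠ 0) :
    normalizedNumber (0 ::ₘ S) = normalizedNumber S := by
  obtain ⟨w, hw⟩ := Nat.exists_eq_add_one_of_ne_zero (flowWeight_pos hS).ne'
  rw [normalizedNumber, normalizedNumber, bgwNumber_zero_cons hS, flowWeight_cons,
    Multiset.sum_cons, hw, zero_add, show 2 * 0 + 1 + (w + 1) - 1 = w + 1 by omega,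
    Nat.add_sub_cancel, Nat.factorial_succ]
  push_cast
  field_simp

theorem sum_map_bgwNumber_cons_erase (m : ℕ) (S : Multiset ℕ) :
    (((S.map fun d : ℕ => (2 * d + 1 : ℚ) * bgwNumber ((d + (m + 1)) ::ₘ S.erase d)).sum : ℚ) : ℝ) =
      (2 * m + flowWeight S + 1)! / 4 ^ (m + S.sum + 2) *
        (S.map fun d : ℕ => (2 * d + 1 : ℝ) *
          normalizedNumber ((d + (m + 1)) ::ₘ S.erase d)).sum := by
  rw [Rat.cast_multiset_sum, Multiset.map_map, ← Multiset.sum_map_mul_left]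
  refine congrArg Multiset.sum (Multiset.map_congr rfl fun d hd => ?_)
  obtain ⟨T, rfl⟩ := Multiset.exists_cons_of_mem hd
  rw [Multiset.erase_cons_head, Function.comp_apply, Multiset.erase_cons_head, Rat.cast_mul,
    cast_bgwNumber_eq (s := m + (d ::ₘ T).sum + 1) (w := 2 * m + flowWeight (d ::ₘ T) + 1)
      (by rw [Multiset.sum_cons, Multiset.sum_cons]; ring)
      (by rw [flowWeight_cons, flowWeight_cons]; ring)]
  push_cast
  ring

theorem cast_bgwNumber_mul_bgwNumber {m : ℕ} {S : Multiset ℕ} {q : ℕ × ℕ}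
    {p : Multiset ℕ × Multiset ℕ} (hq : q ∈ antidiagonal m) (hp : p ∈ S.antidiagonal) :
    (bgwNumber (q.1 ::ₘ p.1) : ℝ) * bgwNumber (q.2 ::ₘ p.2) =
      (2 * m + flowWeight S)! / 4 ^ (m + S.sum + 2) *
        (normalizedNumber (q.1 ::ₘ p.1) * normalizedNumber (q.2 ::ₘ p.2) *
          ((2 * m + flowWeight S).choose (2 * q.1 + flowWeight p.1) : ℝ)⁻¹) := by
  obtain rfl := mem_antidiagonal.1 hq
  obtain rfl := Multiset.mem_antidiagonal.1 hp
  rw [cast_bgwNumber_eq (S := q.1 ::ₘ p.1) (Multiset.sum_cons _ _)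
      (show _ = 2 * q.1 + flowWeight p.1 + 1 by rw [flowWeight_cons]; ring),
    cast_bgwNumber_eq (S := q.2 ::ₘ p.2) (Multiset.sum_cons _ _)
      (show _ = 2 * q.2 + flowWeight p.2 + 1 by rw [flowWeight_cons]; ring),
    flowWeight_add, Multiset.sum_add,
    show 2 * (q.1 + q.2) + (flowWeight p.1 + flowWeight p.2) =
      2 * q.1 + flowWeight p.1 + (2 * q.2 + flowWeight p.2) by ring,
    Nat.cast_add_choose, inv_div]
  field_simp
  ring

/-- The contribution to the recursion of `normalizedNumber` of the products of two numbers. -/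
def productSum (m : ℕ) (S : Multiset ℕ) : ℝ :=
  ∑ q ∈ antidiagonal m, (S.antidiagonal.map fun p =>
    normalizedNumber (q.1 ::ₘ p.1) * normalizedNumber (q.2 ::ₘ p.2) *
      ((2 * m + flowWeight S).choose (2 * q.1 + flowWeight p.1) : ℝ)⁻¹).sum

theorem normalizedNumber_succ_cons (m : ℕ) (S : Multiset ℕ) :
    (2 * (m + 1) + flowWeight S : ℝ) * normalizedNumber ((m + 1) ::ₘ S) =
      (S.map fun d : ℕ => (2 * d + 1 : ℝ) * normalizedNumber ((d + (m + 1)) ::ₘ S.erase d)).sum +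
      2 * ∑ q ∈ antidiagonal m, normalizedNumber (q.1 ::ₘ q.2 ::ₘ S) +
      productSum m S / (2 * (2 * m + 1 + flowWeight S)) := by
  set W := 2 * m + flowWeight S with hW
  have h_left : (bgwNumber ((m + 1) ::ₘ S) : ℝ) =
      (W + 2)! / 4 ^ (m + S.sum + 2) * normalizedNumber ((m + 1) ::ₘ S) :=
    cast_bgwNumber_eq (by rw [Multiset.sum_cons]; ring) (by rw [flowWeight_cons]; omega)
  have h_cut : ∀ q ∈ antidiagonal m, (bgwNumber (q.1 ::ₘ q.2 ::ₘ S) : ℝ) =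
      (W + 1)! / 4 ^ (m + S.sum + 1) * normalizedNumber (q.1 ::ₘ q.2 ::ₘ S) := by
    intro q hq
    obtain rfl := mem_antidiagonal.1 hq
    exact cast_bgwNumber_eq (by rw [Multiset.sum_cons, Multiset.sum_cons]; ring)
      (by rw [flowWeight_cons, flowWeight_cons]; omega)
  have h_prod : ∀ q ∈ antidiagonal m, (((S.antidiagonal.map fun p =>
        bgwNumber (q.1 ::ₘ p.1) * bgwNumber (q.2 ::ₘ p.2)).sum : ℚ) : ℝ) =
      W ! / 4 ^ (m + S.sum + 2) * (S.antidiagonal.map fun p =>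
        normalizedNumber (q.1 ::ₘ p.1) * normalizedNumber (q.2 ::ₘ p.2) *
          (W.choose (2 * q.1 + flowWeight p.1) : ℝ)⁻¹).sum := by
    intro q hq
    rw [Rat.cast_multiset_sum, Multiset.map_map, ← Multiset.sum_map_mul_left]
    refine congrArg Multiset.sum (Multiset.map_congr rfl fun p hp => ?_)
    rw [Function.comp_apply, Rat.cast_mul, cast_bgwNumber_mul_bgwNumber hq hp]
  have h := congrArg (fun x : ℚ => (x : ℝ)) (bgwNumber_succ_cons m S)
  simp only [Rat.cast_add, Rat.cast_mul, Rat.cast_sum, Rat.cast_ofNat, Finset.sum_add_distrib] at h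
  rw [h_left, sum_map_bgwNumber_cons_erase, Finset.sum_congr rfl h_cut,
    Finset.sum_congr rfl h_prod, ← Finset.mul_sum, ← Finset.mul_sum, ← productSum, ← hW,
    Nat.factorial_succ, Nat.factorial_succ, pow_succ 4 (m + S.sum + 1)] at h
  have hW' : (W : ℝ) = 2 * m + flowWeight S := by rw [hW]; push_cast; ring
  rw [show (2 * (m + 1) + flowWeight S : ℝ) = W + 2 by rw [hW']; ring,
    show (2 * m + 1 + flowWeight S : ℝ) = W + 1 by rw [hW']; ring]
  push_cast at h
  field_simp at h ⊢
  linear_combination h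

theorem normalizedNumber_singleton_zero : normalizedNumber {0} = 1 / 2 := by
  rw [normalizedNumber, bgwNumber_singleton_zero]
  norm_num [flowWeight]

theorem normalizedNumber_singleton_succ (k : ℕ) :
    normalizedNumber {k + 1} =
      normalizedNumber {k} * ((2 * k + 3) ^ 2 / ((2 * k + 2) * (2 * k + 4))) := by
  rw [normalizedNumber, normalizedNumber, bgwNumber_singleton, bgwNumber_singleton,
    evalBase_beta_succ (k + 1)]
  simp only [← Multiset.cons_zero, flowWeight_cons, flowWeight_zero, add_zero, Nat.add_sub_cancel,
    Multiset.sum_cons, Multiset.sum_zero]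
  rw [show 2 * (k + 1) = 2 * k + 1 + 1 by ring, Nat.factorial_succ, Nat.factorial_succ]
  push_cast
  field_simp
  ring

theorem normalizedNumber_singleton_mul_wallis (k : ℕ) :
    normalizedNumber {k} * Real.Wallis.W k = (2 * k + 1) / (2 * k + 2) := by
  induction k with
  | zero => simp [normalizedNumber_singleton_zero, Real.Wallis.W]
  | succ k ih =>
    rw [normalizedNumber_singleton_succ, Real.Wallis.W_succ, mul_mul_mul_comm, ih]
    push_cast
    field_simp
    ring

open Topology in
theorem tendsto_normalizedNumber_singleton :
    Tendsto (fun k : ℕ => normalizedNumber {k}) atTop (𝓝 (2 / Real.pi)) := by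
  have h_num : Tendsto (fun k : ℕ => 1 - 1 / 2 * (1 / ((k : ℝ) + 1))) atTop (𝓝 1) := by
    simpa only [mul_zero, sub_zero] using
      ((tendsto_one_div_add_atTop_nhds_zero_nat (𝕜 := ℝ)).const_mul (1 / 2)).const_sub 1
  have h_quot := h_num.div Real.Wallis.tendsto_W_nhds_pi_div_two (by positivity)
  rw [one_div_div] at h_quot
  refine h_quot.congr fun k => ?_
  rw [Pi.div_apply, div_eq_iff (Real.Wallis.W_pos k).ne', normalizedNumber_singleton_mul_wallis]
  field_simp
  ring

/-! ### Bounds for the normalized numbers -/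

theorem abs_sum_map_mul_sub_le {α : Type*} {S : Multiset α} {w f : α → ℝ} {x U : ℝ}
    (hw : ∀ d ∈ S, 0 ≤ w d) (hf : ∀ d ∈ S, |f d - x| ≤ U) :
    |(S.map fun d => w d * f d).sum - (S.map w).sum * x| ≤ (S.map w).sum * U := by
  calc |(S.map fun d => w d * f d).sum - (S.map w).sum * x|
      = |(S.map fun d => w d * (f d - x)).sum| := by
        simp only [mul_sub, Multiset.sum_map_sub, Multiset.sum_map_mul_right]
    _ ≤ (S.map fun d => w d * U).sum := by
        refine Multiset.abs_sum_le_sum_abs.trans ?_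
        rw [Multiset.map_map]
        refine Multiset.sum_map_le_sum_map _ _ fun d hd => ?_
        rw [Function.comp_apply, abs_mul, abs_of_nonneg (hw d hd)]
        exact mul_le_mul_of_nonneg_left (hf d hd) (hw d hd)
    _ = (S.map w).sum * U := Multiset.sum_map_mul_right

theorem cast_flowWeight (S : Multiset ℕ) :
    (flowWeight S : ℝ) = (S.map fun d : ℕ => (2 * d + 1 : ℝ)).sum := by
  rw [flowWeight, Nat.cast_multiset_sum, Multiset.map_map]
  simp

theorem productSum_nonneg (m : ℕ) (S : Multiset ℕ) : 0 ≤ productSum m S := by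
  refine Finset.sum_nonneg fun q _ => Multiset.sum_nonneg fun y hy => ?_
  obtain ⟨p, _, rfl⟩ := Multiset.mem_map.1 hy
  have h_fst := normalizedNumber_nonneg (q.1 ::ₘ p.1)
  have h_snd := normalizedNumber_nonneg (q.2 ::ₘ p.2)
  positivity

theorem productSum_le {m : ℕ} {S : Multiset ℕ} (hS : ∀ d ∈ S, 1 ≤ d) {B : ℝ}
    (hB : ∀ T ≠ 0, flowWeight T < flowWeight ((m + 1) ::ₘ S) → normalizedNumber T ≤ B) :
    productSum m S ≤ 9 * B ^ 2 := by
  rw [mul_comm]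
  refine le_trans ?_
    (mul_le_mul_of_nonneg_left (sum_antidiagonal_inv_choose_le m hS) (sq_nonneg B))
  rw [productSum, Finset.mul_sum]
  refine Finset.sum_le_sum fun q hq => ?_
  rw [← Multiset.sum_map_mul_left]
  refine Multiset.sum_map_le_sum_map _ _ fun p hp => ?_
  have hq := mem_antidiagonal.1 hq
  have h_weight : flowWeight S = flowWeight p.1 + flowWeight p.2 := by
    rw [← Multiset.mem_antidiagonal.1 hp, flowWeight_add]
  have h_fst := hB (q.1 ::ₘ p.1) Multiset.cons_ne_zero
    (by rw [flowWeight_cons, flowWeight_cons]; omega)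
  have h_snd := hB (q.2 ::ₘ p.2) Multiset.cons_ne_zero
    (by rw [flowWeight_cons, flowWeight_cons]; omega)
  have h_nonneg := normalizedNumber_nonneg (q.2 ::ₘ p.2)
  have hB0 := (normalizedNumber_nonneg (q.1 ::ₘ p.1)).trans h_fst
  rw [sq]
  gcongr

/-- The cut-and-join recursion as an approximate averaging property. -/
theorem abs_normalizedNumber_succ_cons_sub_le {m : ℕ} {S : Multiset ℕ} (hS : ∀ d ∈ S, 1 ≤ d)
    {x U V B : ℝ} (hU : ∀ d ∈ S, |normalizedNumber ((d + (m + 1)) ::ₘ S.erase d) - x| ≤ U)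
    (hV : ∀ q ∈ antidiagonal m, |normalizedNumber (q.1 ::ₘ q.2 ::ₘ S) - x| ≤ V)
    (hB : ∀ T ≠ 0, flowWeight T < flowWeight ((m + 1) ::ₘ S) → normalizedNumber T ≤ B) :
    |normalizedNumber ((m + 1) ::ₘ S) - x| ≤
      (flowWeight S * U + 2 * (m + 1) * V) / (2 * (m + 1) + flowWeight S) +
        9 / 2 * B ^ 2 / ((2 * (m + 1) + flowWeight S) * (2 * m + 1 + flowWeight S)) := by
  set M : ℝ := 2 * (m + 1) + flowWeight S with hM
  have hM_pos : 0 < M := by positivity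
  have h_merge := abs_sum_map_mul_sub_le (w := fun d : ℕ => (2 * d + 1 : ℝ))
    (f := fun d => normalizedNumber ((d + (m + 1)) ::ₘ S.erase d)) (fun d _ => by positivity) hU
  rw [← cast_flowWeight] at h_merge
  have h_cut : |∑ q ∈ antidiagonal m, normalizedNumber (q.1 ::ₘ q.2 ::ₘ S) - (m + 1) * x| ≤
      (m + 1) * V := by
    have h := abs_sum_map_mul_sub_le (S := (antidiagonal m).val) (w := fun _ => 1)
      (f := fun q : ℕ × ℕ => normalizedNumber (q.1 ::ₘ q.2 ::ₘ S)) (fun _ _ => zero_le_one) hV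
    simp only [one_mul, Multiset.map_const', Multiset.sum_replicate, Finset.card_val,
      Finset.Nat.card_antidiagonal, nsmul_one, Nat.cast_succ] at h
    exact h
  have h_product_nonneg : 0 ≤ productSum m S / (2 * (2 * m + 1 + flowWeight S)) :=
    div_nonneg (productSum_nonneg m S) (by positivity)
  have h_product_le : productSum m S / (2 * (2 * m + 1 + flowWeight S)) ≤
      9 / 2 * B ^ 2 / (2 * m + 1 + flowWeight S) := by
    rw [div_le_div_iff₀ (by positivity) (by positivity)]
    nlinarith [productSum_le hS hB, (by positivity : (0 : ℝ) < 2 * m + 1 + flowWeight S)]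
  rw [← div_div, div_right_comm, ← add_div, le_div_iff₀ hM_pos, mul_comm, ← abs_of_pos hM_pos,
    ← abs_mul, mul_sub, hM, normalizedNumber_succ_cons, abs_le]
  rw [abs_le] at h_merge h_cut
  constructor <;> linarith [h_merge.1, h_merge.2, h_cut.1, h_cut.2]

/-- An increasing bound for the normalized numbers of weight at most `N`. Since its reciprocal is
`5 / 18 + 9 / 2 / (N - 1)`, its increments dominate the error in the averaging property. -/
def majorant (N : ℝ) : ℝ := 18 * (N - 1) / (5 * (N - 1) + 81)

theorem majorant_mono {x y : ℝ} (hx : 1 ≤ x) (hxy : x ≤ y) : majorant x ≤ majorant y := by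
  unfold majorant
  rw [div_le_div_iff₀ (by linarith) (by linarith)]
  nlinarith

theorem majorant_le_four {N : ℝ} (hN : 1 ≤ N) : majorant N ≤ 4 := by
  unfold majorant
  rw [div_le_iff₀ (by linarith)]
  linarith

theorem majorant_step {N : ℝ} (hN : 2 ≤ N) :
    majorant N + 9 / 2 * majorant N ^ 2 / (N * (N - 1)) ≤ majorant (N + 1) := by
  have h_pred : 0 < N - 1 := by linarith
  have h_pos : 0 < majorant N := div_pos (by positivity) (by positivity)
  have h_sub : majorant (N + 1) - majorant N =
      9 / 2 * (majorant N * majorant (N + 1)) / (N * (N - 1)) := by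
    have : 5 * (N - 1) + 81 ≠ 0 := by positivity
    have : 5 * N + 81 ≠ 0 := by linarith
    unfold majorant
    rw [add_sub_cancel_right]
    field_simp
    ring
  have h_mono : majorant N ≤ majorant (N + 1) := majorant_mono (by linarith) (by linarith)
  rw [← le_sub_iff_add_le', h_sub, sq]
  gcongr

theorem normalizedNumber_le_of_flowWeight_le_four {S : Multiset ℕ} (hS : S ≠ 0)
    (hS4 : flowWeight S ≤ 4) : normalizedNumber S ≤ 9 / 16 := by
  have h_one : normalizedNumber {1} = 9 / 16 := by
    rw [← zero_add 1, normalizedNumber_singleton_succ, normalizedNumber_singleton_zero]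
    norm_num
  induction S using Multiset.induction_on with
  | empty => exact absurd rfl hS
  | cons k R ih =>
    rw [flowWeight_cons] at hS4
    rcases eq_or_ne R 0 with rfl | hR
    · rcases (by omega : k = 0 ∨ k = 1) with rfl | rfl
      · rw [Multiset.cons_zero, normalizedNumber_singleton_zero]
        norm_num
      · exact h_one.le
    rcases k with _ | m
    · rw [normalizedNumber_zero_cons hR]
      exact ih hR (by omega)
    · obtain ⟨d, hd⟩ := Multiset.exists_mem_of_ne_zero hR
      obtain ⟨T, rfl⟩ := Multiset.exists_cons_of_mem hd
      rw [flowWeight_cons] at hS4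
      obtain rfl : T = 0 := by
        by_contra hT
        have := flowWeight_pos hT
        omega
      obtain ⟨rfl, rfl⟩ : m = 0 ∧ d = 0 := by omega
      rw [Multiset.cons_swap, normalizedNumber_zero_cons Multiset.cons_ne_zero]
      exact h_one.le

theorem normalizedNumber_succ_cons_le {m : ℕ} {S : Multiset ℕ} (hS : ∀ d ∈ S, 1 ≤ d) {B : ℝ}
    (hB : ∀ T ≠ 0, flowWeight T < flowWeight ((m + 1) ::ₘ S) → normalizedNumber T ≤ B) :
    normalizedNumber ((m + 1) ::ₘ S) ≤
      B + 9 / 2 * B ^ 2 / ((2 * (m + 1) + flowWeight S) * (2 * m + 1 + flowWeight S)) := by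
  have h_abs : ∀ T ≠ 0, flowWeight T < flowWeight ((m + 1) ::ₘ S) →
      |normalizedNumber T - 0| ≤ B := by
    intro T hT hTS
    rw [sub_zero, abs_of_nonneg (normalizedNumber_nonneg T)]
    exact hB T hT hTS
  have h := abs_normalizedNumber_succ_cons_sub_le hS (x := 0) (U := B) (V := B) (B := B)
    (fun d hd => by
      obtain ⟨T, rfl⟩ := Multiset.exists_cons_of_mem hd
      refine h_abs _ Multiset.cons_ne_zero ?_
      rw [Multiset.erase_cons_head, flowWeight_cons, flowWeight_cons, flowWeight_cons]
      omega)
    (fun q hq => by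
      have hq := mem_antidiagonal.1 hq
      refine h_abs _ Multiset.cons_ne_zero ?_
      rw [flowWeight_cons, flowWeight_cons, flowWeight_cons]
      omega) hB
  rwa [sub_zero, abs_of_nonneg (normalizedNumber_nonneg _), ← add_mul, add_comm (flowWeight S : ℝ),
    mul_div_cancel_left₀ _ (by positivity)] at h

theorem normalizedNumber_le_majorant {N : ℕ} (hN : 4 ≤ N) {S : Multiset ℕ} (hS : S ≠ 0)
    (hSN : flowWeight S ≤ N) : normalizedNumber S ≤ majorant N := by
  induction N, hN using Nat.le_induction generalizing S with
  | base =>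
    exact (normalizedNumber_le_of_flowWeight_le_four hS hSN).trans_eq (by norm_num [majorant])
  | succ N hN ih =>
    have hN' : (4 : ℝ) ≤ N := by exact_mod_cast hN
    have h_mono : majorant N ≤ majorant (N + 1 : ℕ) :=
      majorant_mono (by linarith) (by exact_mod_cast N.le_succ)
    rcases hSN.lt_or_eq with h_lt | h_eq
    · exact (ih hS (Nat.lt_succ_iff.1 h_lt)).trans h_mono
    by_cases h_zero : 0 ∈ S
    · obtain ⟨R, rfl⟩ := Multiset.exists_cons_of_mem h_zero
      rw [flowWeight_cons] at h_eq
      have hR : R ≠ 0 := by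
        rintro rfl
        rw [flowWeight_zero] at h_eq
        omega
      rw [normalizedNumber_zero_cons hR]
      exact (ih hR (by omega)).trans h_mono
    · have h_one_le : ∀ d ∈ S, 1 ≤ d := fun d hd =>
        Nat.one_le_iff_ne_zero.2 fun h => h_zero (h ▸ hd)
      obtain ⟨k, hk⟩ := Multiset.exists_mem_of_ne_zero hS
      obtain ⟨m, rfl⟩ := Nat.exists_eq_add_one_of_ne_zero (Nat.one_le_iff_ne_zero.1 (h_one_le k hk))
      obtain ⟨R, rfl⟩ := Multiset.exists_cons_of_mem hk
      have hR : (2 * (m + 1) + flowWeight R : ℝ) = N := by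
        rw [flowWeight_cons] at h_eq
        exact_mod_cast (by omega : 2 * (m + 1) + flowWeight R = N)
      have h_le := normalizedNumber_succ_cons_le (m := m) (S := R) (B := majorant N)
        (fun d hd => h_one_le d (Multiset.mem_cons_of_mem hd))
        (fun T hT hTS => ih hT (by omega))
      rw [hR, show (2 * m + 1 + flowWeight R : ℝ) = N - 1 by linarith] at h_le
      rw [Nat.cast_succ]
      exact h_le.trans (majorant_step (by linarith))

theorem normalizedNumber_le_four {S : Multiset ℕ} (hS : S ≠ 0) : normalizedNumber S ≤ 4 :=
  (normalizedNumber_le_majorant (le_max_left _ _) hS (le_max_right _ _)).trans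
    (majorant_le_four (by exact_mod_cast (by norm_num : 1 ≤ 4).trans (le_max_left _ _)))

/-! ### Convergence of the normalized numbers -/

/-- The weight of the number `n` of parts in the error bound: it vanishes for a single part, and the
averaging property does not increase it, even with a factor `5 / 4` on cut terms. -/
def partCost (n : ℕ) : ℝ := if n ≤ 1 then 0 else n

theorem partCost_one : partCost 1 = 0 := if_pos le_rfl

theorem partCost_of_two_le {n : ℕ} (hn : 2 ≤ n) : partCost n = n := if_neg (by omega)

theorem partCost_nonneg (n : ℕ) : 0 ≤ partCost n := by
  unfold partCost
  split_ifs <;> positivity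

theorem partCost_le (n : ℕ) : partCost n ≤ n := by
  unfold partCost
  split_ifs
  · positivity
  · exact le_rfl

theorem partCost_mono : Monotone partCost := by
  intro n k h
  unfold partCost
  split_ifs
  · exact le_rfl
  · positivity
  · omega
  · exact_mod_cast h

theorem partCost_step {n : ℕ} (hn : 1 ≤ n) :
    n * partCost n + 5 / 4 * partCost (n + 2) ≤ (n + 1) * partCost (n + 1) := by
  rw [partCost_of_two_le (by omega : 2 ≤ n + 2), partCost_of_two_le (by omega : 2 ≤ n + 1)]
  rcases hn.eq_or_lt with rfl | hn
  · norm_num [partCost_one]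
  · rw [partCost_of_two_le hn]
    have : (2 : ℝ) ≤ n := by exact_mod_cast hn
    push_cast
    nlinarith

theorem partCost_average {n : ℕ} (hn : 1 ≤ n) {p q : ℝ} (hp : 0 ≤ p) (hpq : n * p ≤ q) :
    q * partCost n + p * (5 / 4 * partCost (n + 2)) ≤ (p + q) * partCost (n + 1) := by
  have h_step := partCost_step hn
  have h_mono : partCost n ≤ partCost (n + 1) := partCost_mono n.le_succ
  calc q * partCost n + p * (5 / 4 * partCost (n + 2))
      = (q - n * p) * partCost n + p * (n * partCost n + 5 / 4 * partCost (n + 2)) := by ring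
    _ ≤ (q - n * p) * partCost (n + 1) + p * ((n + 1) * partCost (n + 1)) := by
        have := sub_nonneg.2 hpq
        gcongr
    _ = (p + q) * partCost (n + 1) := by ring

/-- A bound for the distance of the normalized numbers to `L`, for `n` parts with sum `s` and weight
at most `N`, given that for one part `g ≥ G` this distance is at most `ε`. -/
def errorBound (ε : ℝ) (G N n s : ℕ) : ℝ :=
  ε + 4 * (5 / 4) ^ G * (partCost n * (4 / 5) ^ s) + 72 * (1 / (2 * G) - 1 / (N - 1))

section

variable {L ε : ℝ} {G N : ℕ}

theorem one_div_sub_one_div_nonneg (hG : 1 ≤ G) (hN : 2 * G + 1 ≤ N) :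
    (0 : ℝ) ≤ 1 / (2 * G) - 1 / (N - 1) := by
  have hG' : (0 : ℝ) < 2 * G := by positivity
  have hN' : (2 * G + 1 : ℝ) ≤ N := by exact_mod_cast hN
  exact sub_nonneg.2 (one_div_le_one_div_of_le hG' (by linarith))

theorem le_errorBound (hG : 1 ≤ G) (hN : 2 * G + 1 ≤ N) (n s : ℕ) : ε ≤ errorBound ε G N n s := by
  have h_cost := partCost_nonneg n
  have h_weight := one_div_sub_one_div_nonneg hG hN
  rw [errorBound, add_assoc]
  exact le_add_of_nonneg_right (by positivity)

theorem errorBound_succ (hN : 2 ≤ N) (n s : ℕ) :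
    errorBound ε G (N + 1) n s = errorBound ε G N n s + 9 / 2 * 4 ^ 2 / (N * (N - 1)) := by
  have hN' : (2 : ℝ) ≤ N := by exact_mod_cast hN
  have h_diff : (1 : ℝ) / (N - 1) - 1 / N = 1 / (N * (N - 1)) := by
    have : (N : ℝ) - 1 ≠ 0 := by linarith
    field_simp
    ring
  rw [errorBound, errorBound, Nat.cast_succ, add_sub_cancel_right, mul_div_assoc,
    ← mul_one_div (_ ^ 2 : ℝ), ← h_diff]
  ring

theorem errorBound_le_succ (hN : 2 ≤ N) {n k : ℕ} (hnk : n ≤ k) (s : ℕ) :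
    errorBound ε G N n s ≤ errorBound ε G (N + 1) k s := by
  have hN' : (2 : ℝ) ≤ N := by exact_mod_cast hN
  have h_error : (0 : ℝ) ≤ 9 / 2 * 4 ^ 2 / (N * (N - 1)) :=
    div_nonneg (by positivity) (mul_nonneg (by linarith) (by linarith))
  rw [errorBound_succ hN]
  refine le_add_of_le_of_nonneg ?_ h_error
  unfold errorBound
  gcongr
  exact partCost_mono hnk

theorem errorBound_average {n s : ℕ} (hn : 1 ≤ n) {p q : ℝ} (hp : 0 ≤ p) (hpq : n * p ≤ q) :
    q * errorBound ε G N n (s + 1) + p * errorBound ε G N (n + 2) s ≤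
      (p + q) * errorBound ε G N (n + 1) (s + 1) := by
  have h_average := mul_le_mul_of_nonneg_left (partCost_average hn hp hpq)
    (by positivity : (0 : ℝ) ≤ 4 * (5 / 4) ^ G * (4 / 5) ^ (s + 1))
  have h_pow : (4 / 5 : ℝ) ^ s = 5 / 4 * (4 / 5) ^ (s + 1) := by ring
  unfold errorBound
  rw [h_pow]
  linarith

theorem abs_normalizedNumber_singleton_sub_le (hG : 1 ≤ G) (hN : 2 * G + 1 ≤ N)
    (h_single : ∀ g ≥ G, |normalizedNumber {g} - L| ≤ ε) {S : Multiset ℕ} (hS : S.card ≤ 1)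
    (hSG : G ≤ S.sum) : |normalizedNumber S - L| ≤ errorBound ε G N S.card S.sum := by
  have h_ne : S ≠ 0 := by
    rintro rfl
    rw [Multiset.sum_zero] at hSG
    omega
  obtain ⟨g, rfl⟩ := Multiset.card_eq_one.1 (hS.antisymm (Multiset.card_pos.2 h_ne))
  exact (h_single g (by rwa [Multiset.sum_singleton] at hSG)).trans (le_errorBound hG hN _ _)

theorem abs_normalizedNumber_merge_sub_le {m : ℕ} {R : Multiset ℕ}
    (ih : ∀ T : Multiset ℕ, G ≤ T.sum → flowWeight T ≤ N →
      |normalizedNumber T - L| ≤ errorBound ε G N T.card T.sum)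
    (hRG : G ≤ R.sum + m + 1) (hRN : flowWeight R + 2 * (m + 1) ≤ N) {d : ℕ} (hd : d ∈ R) :
    |normalizedNumber ((d + (m + 1)) ::ₘ R.erase d) - L| ≤
      errorBound ε G N R.card (R.sum + m + 1) := by
  obtain ⟨T, rfl⟩ := Multiset.exists_cons_of_mem hd
  rw [flowWeight_cons] at hRN
  have h_sum : ((d + (m + 1)) ::ₘ T).sum = (d ::ₘ T).sum + m + 1 := by
    rw [Multiset.sum_cons, Multiset.sum_cons]
    ring
  rw [Multiset.erase_cons_head]
  have h := ih ((d + (m + 1)) ::ₘ T) (h_sum ▸ hRG) (by rw [flowWeight_cons]; omega)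
  rwa [h_sum, Multiset.card_cons, ← Multiset.card_cons d T] at h

theorem abs_normalizedNumber_cut_sub_le (hG : 1 ≤ G) (hN : 2 * G + 1 ≤ N) (hε : 0 ≤ ε)
    (hL : ∀ S ≠ 0, |normalizedNumber S - L| ≤ 4) {m : ℕ} {R : Multiset ℕ}
    (ih : ∀ T : Multiset ℕ, G ≤ T.sum → flowWeight T ≤ N →
      |normalizedNumber T - L| ≤ errorBound ε G N T.card T.sum)
    (hRN : flowWeight R + 2 * (m + 1) ≤ N) {q : ℕ × ℕ} (hq : q ∈ antidiagonal m) :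
    |normalizedNumber (q.1 ::ₘ q.2 ::ₘ R) - L| ≤ errorBound ε G N (R.card + 2) (R.sum + m) := by
  have hq := mem_antidiagonal.1 hq
  have h_sum : (q.1 ::ₘ q.2 ::ₘ R).sum = R.sum + m := by
    rw [Multiset.sum_cons, Multiset.sum_cons]
    omega
  rcases lt_or_ge (R.sum + m) G with h_lt | h_ge
  · have h_pow : (1 : ℝ) ≤ (5 / 4) ^ G * (4 / 5) ^ (R.sum + m) := by
      rw [← Nat.add_sub_cancel' h_lt.le, pow_add, mul_right_comm, ← mul_pow]
      norm_num
      exact one_le_pow₀ (by norm_num)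
    have h_cost : 1 ≤ partCost (R.card + 2) := by
      rw [partCost_of_two_le (by omega)]
      exact_mod_cast (by omega)
    have h_weight := one_div_sub_one_div_nonneg hG hN
    refine (hL _ Multiset.cons_ne_zero).trans ?_
    unfold errorBound
    nlinarith [mul_le_mul h_pow h_cost zero_le_one (zero_le_one.trans h_pow)]
  · have h := ih (q.1 ::ₘ q.2 ::ₘ R) (h_sum ▸ h_ge)
      (by rw [flowWeight_cons, flowWeight_cons]; omega)
    rwa [h_sum, Multiset.card_cons, Multiset.card_cons] at h

theorem abs_normalizedNumber_succ_cons_sub_le_errorBound (hG : 1 ≤ G) (hN : 2 * G + 1 ≤ N)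
    (hε : 0 ≤ ε) (hL : ∀ S ≠ 0, |normalizedNumber S - L| ≤ 4)
    (ih : ∀ T : Multiset ℕ, G ≤ T.sum → flowWeight T ≤ N →
      |normalizedNumber T - L| ≤ errorBound ε G N T.card T.sum)
    {m : ℕ} {R : Multiset ℕ} (hR : ∀ d ∈ R, m + 1 ≤ d) (hR_card : 1 ≤ R.card)
    (hRG : G ≤ R.sum + m + 1) (hRN : flowWeight R + 2 * (m + 1) = N) :
    |normalizedNumber ((m + 1) ::ₘ R) - L| ≤
      errorBound ε G (N + 1) (R.card + 1) (R.sum + m + 1) := by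
  have hN' : (3 : ℝ) ≤ N := by exact_mod_cast (by omega : 3 ≤ N)
  have hRN' : (2 * (m + 1) + flowWeight R : ℝ) = N := by
    rw [← hRN]
    push_cast
    ring
  have h_card : (R.card * (2 * (m + 1)) : ℝ) ≤ flowWeight R := by
    have : R.card * (m + 1) ≤ R.sum := Multiset.card_nsmul_le_sum hR
    have := flowWeight_eq R
    exact_mod_cast (by linarith : R.card * (2 * (m + 1)) ≤ flowWeight R)
  have h := abs_normalizedNumber_succ_cons_sub_le (m := m) (S := R) (x := L) (B := 4)
    (fun d hd => (Nat.le_add_left 1 m).trans (hR d hd))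
    (fun d hd => abs_normalizedNumber_merge_sub_le ih hRG hRN.le hd)
    (fun q hq => abs_normalizedNumber_cut_sub_le hG hN hε hL ih hRN.le hq)
    (fun T hT _ => normalizedNumber_le_four hT)
  have h_average := errorBound_average (ε := ε) (G := G) (N := N) (s := R.sum + m) hR_card
    (by positivity) h_card
  rw [hRN', show (2 * m + 1 + flowWeight R : ℝ) = N - 1 by linarith] at h
  rw [hRN'] at h_average
  rw [errorBound_succ (by omega)]
  refine h.trans (add_le_add_left ?_ _)
  rwa [div_le_iff₀' (by linarith)]

theorem abs_normalizedNumber_sub_le (hG : 1 ≤ G) (hN : 2 * G + 1 ≤ N) (hε : 0 ≤ ε)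
    (hL : ∀ S ≠ 0, |normalizedNumber S - L| ≤ 4)
    (h_single : ∀ g ≥ G, |normalizedNumber {g} - L| ≤ ε) {S : Multiset ℕ} (hSG : G ≤ S.sum)
    (hSN : flowWeight S ≤ N) : |normalizedNumber S - L| ≤ errorBound ε G N S.card S.sum := by
  induction N, hN using Nat.le_induction generalizing S with
  | base =>
    rw [flowWeight_eq] at hSN
    exact abs_normalizedNumber_singleton_sub_le hG le_rfl h_single (by omega) hSG
  | succ N hN ih =>
    rcases hSN.lt_or_eq with h_lt | h_eq
    · exact (ih hSG (Nat.lt_succ_iff.1 h_lt)).trans (errorBound_le_succ (by omega) le_rfl _)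
    rcases Nat.lt_or_ge S.card 2 with h_card | h_card
    · exact abs_normalizedNumber_singleton_sub_le hG (by omega) h_single (by omega) hSG
    obtain ⟨k, hk, h_min⟩ : ∃ k ∈ S, ∀ d ∈ S, k ≤ d := by
      simpa using S.toFinset.exists_min_image id
        (Multiset.toFinset_nonempty.2 (Multiset.card_pos.1 (by omega)))
    obtain ⟨R, rfl⟩ := Multiset.exists_cons_of_mem hk
    rw [Multiset.sum_cons] at hSG ⊢
    rw [flowWeight_cons] at h_eq
    rw [Multiset.card_cons] at h_card ⊢
    rcases k with _ | m
    · rw [zero_add] at hSG ⊢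
      rw [normalizedNumber_zero_cons (Multiset.card_pos.1 (by omega))]
      exact (ih hSG (by omega)).trans (errorBound_le_succ (by omega) (by omega) _)
    · rw [add_comm (m + 1), ← add_assoc] at hSG ⊢
      exact abs_normalizedNumber_succ_cons_sub_le_errorBound hG hN hε hL @ih
        (fun d hd => h_min d (Multiset.mem_cons_of_mem hd)) (by omega) hSG (by omega)

end

theorem abs_normalizedNumber_sub_two_div_pi_le {S : Multiset ℕ} (hS : S ≠ 0) :
    |normalizedNumber S - 2 / Real.pi| ≤ 4 := by
  have h_le_one : 2 / Real.pi ≤ 1 := (div_le_one Real.pi_pos).2 Real.two_le_pi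
  exact abs_sub_le_of_nonneg_of_le (normalizedNumber_nonneg S) (normalizedNumber_le_four hS)
    (by positivity) (by linarith)

open Topology in
theorem tendsto_normalizedNumber {ι : Type*} {l : Filter ι} {S : ι → Multiset ℕ}
    (h_sum : Tendsto (fun i => (S i).sum) l atTop)
    (h_card : Tendsto (fun i => (S i).card * (4 / 5 : ℝ) ^ (S i).sum) l (𝓝 0)) :
    Tendsto (fun i => normalizedNumber (S i)) l (𝓝 (2 / Real.pi)) := by
  rw [Metric.tendsto_nhds]
  intro η hη
  obtain ⟨G, h_single, hGη, hG⟩ : ∃ G : ℕ, (∀ g ≥ G, |normalizedNumber {g} - 2 / Real.pi| ≤ η / 4) ∧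
      72 * (1 / (2 * G)) < η / 4 ∧ 1 ≤ G := by
    have h_near : ∀ᶠ g in atTop, |normalizedNumber {g} - 2 / Real.pi| ≤ η / 4 :=
      (Metric.tendsto_nhds.1 tendsto_normalizedNumber_singleton (η / 4) (by positivity)).mono
        fun _ hg => hg.le
    have h_inv : Tendsto (fun G : ℕ => 72 * (1 / (2 * (G : ℝ)))) atTop (𝓝 (72 * (2⁻¹ * 0))) := by
      simp only [one_div, mul_inv]
      exact ((tendsto_inv_atTop_nhds_zero_nat (𝕜 := ℝ)).const_mul 2⁻¹).const_mul 72
    have h := h_inv.eventually_lt_const (u := η / 4) (by simpa using hη)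
    exact ((eventually_forall_ge_atTop.2 h_near).and (h.and (eventually_ge_atTop 1))).exists
  have h_card_lt := (h_card.const_mul (4 * (5 / 4) ^ G)).eventually_lt_const
    (u := η / 4) (by simpa using hη)
  filter_upwards [h_card_lt, h_sum.eventually_ge_atTop G] with i hi_card hi_sum
  have h_bound := abs_normalizedNumber_sub_le hG (le_max_right (flowWeight (S i)) _)
    (by positivity) (fun T hT => abs_normalizedNumber_sub_two_div_pi_le hT) h_single hi_sum
    (le_max_left _ _)
  have h_cost : 4 * (5 / 4) ^ G * (partCost (S i).card * (4 / 5) ^ (S i).sum) ≤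
      4 * (5 / 4) ^ G * ((S i).card * (4 / 5 : ℝ) ^ (S i).sum) := by
    gcongr
    exact partCost_le _
  have h_weight : (0 : ℝ) ≤ 1 / ((max (flowWeight (S i)) (2 * G + 1) : ℕ) - 1) :=
    one_div_nonneg.2 (sub_nonneg.2 (by exact_mod_cast (by omega)))
  rw [Real.dist_eq]
  rw [errorBound] at h_bound
  linarith

open Topology in
theorem tendsto_normalizedNumber_replicate {d : ℕ} (hd : 1 ≤ d) :
    Tendsto (fun n => normalizedNumber (Multiset.replicate n d)) atTop (𝓝 (2 / Real.pi)) := by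
  refine tendsto_normalizedNumber ?_ ?_
  · simp only [Multiset.sum_replicate, smul_eq_mul]
    exact tendsto_id.atTop_mul_const' (by omega)
  · have h := tendsto_self_mul_const_pow_of_lt_one (r := 4 / 5) (by norm_num) (by norm_num)
    refine squeeze_zero (fun n => by positivity) (fun n => ?_) h
    rw [Multiset.card_replicate, Multiset.sum_replicate, smul_eq_mul]
    refine mul_le_mul_of_nonneg_left ?_ n.cast_nonneg
    exact pow_le_pow_of_le_one (by norm_num) (by norm_num) (Nat.le_mul_of_pos_right n hd)

/-! ### The hierarchy on power series in `w = X⁻¹` -/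

section EulerDerivation

variable {R : Type*} [CommRing R]

/-- The Euler derivation `θ = w d/dw` of power series in `w`. -/
def eulerDeriv : Derivation R (PowerSeries R) (PowerSeries R) :=
  PowerSeries.X (R := R) • PowerSeries.derivative R

theorem eulerDeriv_apply (f : PowerSeries R) :
    eulerDeriv f = PowerSeries.X * PowerSeries.derivative R f :=
  rfl

theorem coeff_eulerDeriv (f : PowerSeries R) (k : ℕ) :
    coeff k (eulerDeriv f) = k * coeff k f :=
  coeff_X_mul_derivative f k

theorem eulerDeriv_neg_X_pow_mul (k : ℕ) (f : PowerSeries R) :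
    eulerDeriv ((-PowerSeries.X) ^ k * f) = (-PowerSeries.X) ^ k * (k • f + eulerDeriv f) := by
  have eulerDeriv_neg_X_pow :
      eulerDeriv ((-PowerSeries.X) ^ k) = k • (-(PowerSeries.X : PowerSeries R)) ^ k := by
    cases k with
    | zero => simp
    | succ k =>
      rw [Derivation.leibniz_pow, map_neg, eulerDeriv_apply, PowerSeries.derivative_X, mul_one,
        Nat.add_sub_cancel, smul_eq_mul, pow_succ]
  rw [Derivation.leibniz, eulerDeriv_neg_X_pow, smul_eq_mul, smul_eq_mul, mul_smul_comm, mul_add,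
    mul_smul_comm, mul_comm f, add_comm]

theorem X_pow_dvd_eulerDeriv {K : ℕ} {f : PowerSeries R} (h : PowerSeries.X ^ K ∣ f) :
    PowerSeries.X ^ K ∣ eulerDeriv f := by
  rw [PowerSeries.X_pow_dvd_iff] at h ⊢
  intro k hk
  rw [coeff_eulerDeriv, h k hk, mul_zero]

/-- The derivation `d/dX = -w² d/dw` of power series in `w = X⁻¹`. -/
def xDeriv : Derivation R (PowerSeries R) (PowerSeries R) :=
  -(PowerSeries.X (R := R) • eulerDeriv)

theorem xDeriv_apply (f : PowerSeries R) : xDeriv f = -(PowerSeries.X * eulerDeriv f) :=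
  rfl

theorem X_pow_succ_dvd_xDeriv {K : ℕ} {f : PowerSeries R} (h : PowerSeries.X ^ K ∣ f) :
    PowerSeries.X ^ (K + 1) ∣ xDeriv f := by
  rw [xDeriv_apply, dvd_neg, pow_succ']
  exact mul_dvd_mul_left _ (X_pow_dvd_eulerDeriv h)

theorem X_pow_dvd_iterate_xDeriv {K : ℕ} {f : PowerSeries R} (h : PowerSeries.X ^ K ∣ f)
    (i : ℕ) : PowerSeries.X ^ K ∣ xDeriv^[i] f := by
  induction i with
  | zero => exact h
  | succ i ih =>
    rw [Function.iterate_succ_apply']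
    exact (pow_dvd_pow _ K.le_succ).trans (X_pow_succ_dvd_xDeriv ih)

end EulerDerivation

/-- The left-hand side `P34` of the hierarchy, as a power series in `w = X⁻¹`; `-X d/dX` becomes
`w d/dw`. -/
def seriesP34 (d : ℕ) (f : PowerSeries ℂ) : PowerSeries ℂ :=
  (2 ^ (2 * d + 1) * ((2 * d + 1)‼ : ℂ)) •
      xDeriv (MvPolynomial.aeval (fun i => (1 / 2 : ℂ) • xDeriv^[i] f) (m d)) +
    eulerDeriv f - (2 : ℂ) • f

theorem derivative_ofPowerSeries {R : Type*} [CommRing R] (f : PowerSeries R) :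
    LaurentSeries.derivative R (HahnSeries.ofPowerSeries ℤ R f) =
      HahnSeries.ofPowerSeries ℤ R (PowerSeries.derivative R f) := by
  ext n
  rw [LaurentSeries.derivative_apply, LaurentSeries.hasseDeriv_coeff, PowerSeries.coeff_coe,
    PowerSeries.coeff_coe, Nat.cast_one, Ring.choose_one_right]
  rcases lt_trichotomy n (-1) with hn | rfl | hn
  · rw [if_pos (by omega), if_pos (by omega), smul_zero]
  · simp
  · obtain ⟨k, rfl⟩ := Int.eq_ofNat_of_zero_le (show 0 ≤ n by omega)
    rw [if_neg (by omega), if_neg (by omega), PowerSeries.coeff_derivative,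
      show ((k : ℤ) + 1).natAbs = k + 1 by omega, show (k : ℤ).natAbs = k by omega, zsmul_eq_mul]
    push_cast
    ring

theorem dX_ofPowerSeries (f : PowerSeries ℂ) :
    dX (HahnSeries.ofPowerSeries ℤ ℂ f) = HahnSeries.ofPowerSeries ℤ ℂ (xDeriv f) := by
  rw [dX, derivative_ofPowerSeries, xDeriv_apply, eulerDeriv_apply, ← mul_assoc, ← sq, map_neg,
    map_mul, HahnSeries.ofPowerSeries_X_pow]
  rfl

theorem iterate_dX_ofPowerSeries (i : ℕ) (f : PowerSeries ℂ) :
    dX^[i] (HahnSeries.ofPowerSeries ℤ ℂ f) = HahnSeries.ofPowerSeries ℤ ℂ (xDeriv^[i] f) :=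
  ((Function.Semiconj.iterate_right (fun f => (dX_ofPowerSeries f).symm) i) f).symm

theorem varX_mul_xDeriv (f : PowerSeries ℂ) :
    varX * HahnSeries.ofPowerSeries ℤ ℂ (xDeriv f) =
      -HahnSeries.ofPowerSeries ℤ ℂ (eulerDeriv f) := by
  have varX_mul_X : varX * HahnSeries.ofPowerSeries ℤ ℂ PowerSeries.X = 1 := by
    rw [varX, HahnSeries.ofPowerSeries_X, HahnSeries.single_mul_single]
    norm_num
  rw [xDeriv_apply, map_neg, map_mul]
  linear_combination (-HahnSeries.ofPowerSeries ℤ ℂ (eulerDeriv f)) * varX_mul_X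

theorem P34_ofPowerSeries (d : ℕ) (f : PowerSeries ℂ) :
    P34 d (HahnSeries.ofPowerSeries ℤ ℂ f) = HahnSeries.ofPowerSeries ℤ ℂ (seriesP34 d f) := by
  have smul_coe (c : ℂ) (g : PowerSeries ℂ) :
      HahnSeries.ofPowerSeries ℤ ℂ (c • g) = c • HahnSeries.ofPowerSeries ℤ ℂ g := by
    rw [PowerSeries.smul_eq_C_mul, map_mul, HahnSeries.ofPowerSeries_C, HahnSeries.C_mul_eq_smul]
  have aeval_coe (g : ℕ → PowerSeries ℂ) (a : DiffPoly) :
      MvPolynomial.aeval (fun i => HahnSeries.ofPowerSeries ℤ ℂ (g i)) a =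
        HahnSeries.ofPowerSeries ℤ ℂ (MvPolynomial.aeval g a) :=
    (MvPolynomial.comp_aeval_apply g (HahnSeries.ofPowerSeries ℤ ℂ).toRatAlgHom a).symm
  simp only [P34, seriesP34, iterate_dX_ofPowerSeries, ← smul_coe, aeval_coe, dX_ofPowerSeries,
    varX_mul_xDeriv, map_sub, map_add, sub_neg_eq_add]

/-- The ansatz `∑ yₙ w^((2d+1)n+2)` as a power series in `w = X⁻¹`. -/
def ansatzSeries (d : ℕ) (y : ℕ → ℂ) : PowerSeries ℂ :=
  PowerSeries.mk fun k => if 2 ≤ k ∧ (2 * d + 1) ∣ k - 2 then y ((k - 2) / (2 * d + 1)) else 0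

theorem isFormalSolution_iff (d : ℕ) (y : ℕ → ℂ) :
    IsFormalSolution d y ↔ y 0 = 1 / 4 ∧ seriesP34 d (ansatzSeries d y) = 0 := by
  refine and_congr_right fun _ => ?_
  rw [ansatz, ← ansatzSeries, P34_ofPowerSeries,
    map_eq_zero_iff _ HahnSeries.ofPowerSeries_injective]

/-! ### Uniqueness of the formal solution -/

theorem dvd_aeval_sub_aeval {σ R B : Type*} [CommRing R] [CommRing B] [Algebra R B] {x : B}
    {g g' : σ → B} (h : ∀ i, x ∣ g i - g' i) (a : MvPolynomial σ R) :
    x ∣ MvPolynomial.aeval g a - MvPolynomial.aeval g' a := by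
  simp only [← Ideal.mem_span_singleton, ← Ideal.Quotient.mk_eq_mk_iff_sub_mem,
    ← Ideal.Quotient.mkₐ_eq_mk R, MvPolynomial.comp_aeval_apply] at h ⊢
  simp only [h]

/-- The nonlinear term raises the order of vanishing of a difference, so that the linear terms
`θ - 2` determine the leading coefficient. -/
theorem coeff_seriesP34_sub (d : ℕ) {K : ℕ} {f g : PowerSeries ℂ}
    (h : PowerSeries.X ^ K ∣ f - g) :
    coeff K (seriesP34 d f) - coeff K (seriesP34 d g) = (K - 2) * (coeff K f - coeff K g) := by
  have dvd_jet (i : ℕ) : PowerSeries.X ^ K ∣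
      (1 / 2 : ℂ) • xDeriv^[i] f - (1 / 2 : ℂ) • xDeriv^[i] g := by
    rw [← smul_sub, ← iterate_map_sub, PowerSeries.smul_eq_C_mul]
    exact (X_pow_dvd_iterate_xDeriv h i).mul_left _
  have coeff_nonlinear := PowerSeries.X_pow_dvd_iff.1
    (X_pow_succ_dvd_xDeriv (dvd_aeval_sub_aeval dvd_jet (m d))) K K.lt_succ_self
  rw [map_sub, map_sub, sub_eq_zero] at coeff_nonlinear
  simp only [seriesP34, map_sub, map_add, PowerSeries.coeff_smul, coeff_nonlinear,
    coeff_eulerDeriv, smul_eq_mul]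
  ring

theorem coeff_ansatzSeries (d n : ℕ) (y : ℕ → ℂ) :
    coeff ((2 * d + 1) * n + 2) (ansatzSeries d y) = y n := by
  rw [ansatzSeries, PowerSeries.coeff_mk, Nat.add_sub_cancel,
    if_pos ⟨Nat.le_add_left .., dvd_mul_right ..⟩, Nat.mul_div_cancel_left _ (Nat.succ_pos _)]

theorem X_pow_dvd_ansatzSeries_sub (d : ℕ) {n : ℕ} {y y' : ℕ → ℂ} (h : ∀ k < n, y k = y' k) :
    PowerSeries.X ^ ((2 * d + 1) * n + 2) ∣ ansatzSeries d y - ansatzSeries d y' := by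
  refine PowerSeries.X_pow_dvd_iff.2 fun k hk => ?_
  rw [map_sub, sub_eq_zero, ansatzSeries, ansatzSeries, PowerSeries.coeff_mk, PowerSeries.coeff_mk]
  split_ifs with hk'
  · exact h _ (Nat.div_lt_of_lt_mul (by omega))
  · rfl

theorem isFormalSolution_unique {d : ℕ} {y y' : ℕ → ℂ} (hy : IsFormalSolution d y)
    (hy' : IsFormalSolution d y') : y = y' := by
  rw [isFormalSolution_iff] at hy hy'
  funext n
  induction n using Nat.strong_induction_on with
  | _ n ih =>
    rcases eq_or_ne n 0 with rfl | hn
    · rw [hy.1, hy'.1]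
    have hdiff := coeff_seriesP34_sub d (X_pow_dvd_ansatzSeries_sub d ih)
    rw [hy.2, hy'.2, sub_self, coeff_ansatzSeries, coeff_ansatzSeries, Nat.cast_add,
      Nat.cast_ofNat, add_sub_cancel_right, eq_comm, mul_eq_zero, Nat.cast_eq_zero] at hdiff
    exact sub_eq_zero.1 (hdiff.resolve_left (by positivity))

/-! ### Weighted scaling of the variables -/

theorem eq_C_mul_X_pow_of_X_mul_derivative {B : Type*} [CommRing B] [Algebra ℚ B]
    {p : Polynomial B} {W : ℕ} (hp : Polynomial.X * Polynomial.derivative p = (W : ℚ) • p) :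
    p = Polynomial.C (p.coeff W) * Polynomial.X ^ W := by
  ext k
  have hk : ((k : ℚ) - W) • p.coeff k = 0 := by
    have := congrArg (Polynomial.coeff · k) hp
    cases k with
    | zero => simpa [eq_comm] using this
    | succ k =>
      rw [Polynomial.coeff_X_mul, Polynomial.coeff_derivative, Polynomial.coeff_smul] at this
      rw [sub_smul, ← this, Nat.cast_smul_eq_nsmul, nsmul_eq_mul, Nat.cast_succ, mul_comm, sub_self]
  rw [Polynomial.coeff_C_mul_X_pow]
  split_ifs with h
  · rw [h]
  · exact (smul_eq_zero.1 hk).resolve_left (sub_ne_zero.2 (Nat.cast_injective.ne h))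

theorem aeval_pow_mul_of_mem_weightSpace {B : Type*} [CommRing B] [Algebra ℚ B] {a : DiffPoly}
    {W : ℕ} (ha : a ∈ weightSpace W) (r : B) (g : ℕ → B) :
    MvPolynomial.aeval (fun i => r ^ (i + 2) * g i) a = r ^ W * MvPolynomial.aeval g a := by
  let σ : DiffPoly →ₐ[ℚ] Polynomial B :=
    MvPolynomial.aeval fun i => Polynomial.X ^ (i + 2) * Polynomial.C (g i)
  let θ : Derivation ℚ (Polynomial B) (Polynomial B) :=
    ((Polynomial.X : Polynomial B) • Polynomial.derivative').restrictScalars ℚ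
  have θ_apply (p : Polynomial B) : θ p = Polynomial.X * Polynomial.derivative p := rfl
  have θ_σ : θ (σ a) = (W : ℚ) • σ a := by
    rw [← map_smul, ← mem_weightSpace.1 ha]
    refine (map_derivation_eq_derivation_map_of_X (fun i => ?_) a).symm
    rw [θ_apply, weightDeriv_X, map_smul, MvPolynomial.aeval_X, Polynomial.derivative_mul,
      Polynomial.derivative_X_pow, Polynomial.derivative_C, Algebra.smul_def]
    simp only [map_add, map_natCast, map_ofNat, mul_zero, add_zero]
    push_cast
    ring
  have aeval_eq (z : B) :
      MvPolynomial.aeval (fun i => z ^ (i + 2) * g i) a = (σ a).coeff W * z ^ W := by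
    have := congrArg (Polynomial.eval z) (eq_C_mul_X_pow_of_X_mul_derivative θ_σ)
    rw [Polynomial.eval_mul, Polynomial.eval_C, Polynomial.eval_pow, Polynomial.eval_X] at this
    rw [← this]
    change _ = (Polynomial.aeval z).restrictScalars ℚ (σ a)
    rw [MvPolynomial.comp_aeval_apply]
    simp only [AlgHom.restrictScalars_apply, map_mul, map_pow, Polynomial.aeval_X,
      Polynomial.aeval_C, Algebra.algebraMap_self, RingHom.id_apply]
  have hone := aeval_eq 1
  simp only [one_pow, one_mul, mul_one] at hone
  rw [aeval_eq, hone, mul_comm]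

/-! ### Taylor series along a derivation -/

section Taylor

variable {A K : Type*} [CommRing A] [Algebra ℚ A] [Field K] [CharZero K]

/-- The Taylor series `∑ Φ(Dⁿ a) tⁿ / n!`: the value of `Φ` after flowing along `D` for
time `t`. -/
def taylorSeries (D : Derivation ℚ A A) (Φ : A →ₐ[ℚ] K) (a : A) : PowerSeries K :=
  PowerSeries.mk fun n => Φ (D^[n] a) / (n ! : K)

theorem coeff_taylorSeries (D : Derivation ℚ A A) (Φ : A →ₐ[ℚ] K) (a : A) (n : ℕ) :
    coeff n (taylorSeries D Φ a) = Φ (D^[n] a) / (n ! : K) :=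
  PowerSeries.coeff_mk _ _

theorem derivative_taylorSeries (D : Derivation ℚ A A) (Φ : A →ₐ[ℚ] K) (a : A) :
    PowerSeries.derivative K (taylorSeries D Φ a) = taylorSeries D Φ (D a) := by
  ext n
  have := Nat.cast_add_one_ne_zero (R := K) n
  have : (n ! : K) ≠ 0 := Nat.cast_ne_zero.2 n.factorial_ne_zero
  rw [PowerSeries.coeff_derivative, coeff_taylorSeries, coeff_taylorSeries,
    Function.iterate_succ_apply, Nat.factorial_succ]
  push_cast
  field_simp

theorem taylorSeries_one (D : Derivation ℚ A A) (Φ : A →ₐ[ℚ] K) : taylorSeries D Φ 1 = 1 := by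
  ext n
  cases n <;> simp [coeff_taylorSeries, PowerSeries.coeff_one]

theorem taylorSeries_add (D : Derivation ℚ A A) (Φ : A →ₐ[ℚ] K) (a b : A) :
    taylorSeries D Φ (a + b) = taylorSeries D Φ a + taylorSeries D Φ b := by
  ext n
  simp only [coeff_taylorSeries, map_add, iterate_map_add, add_div]

theorem taylorSeries_mul (D : Derivation ℚ A A) (Φ : A →ₐ[ℚ] K) (a b : A) :
    taylorSeries D Φ (a * b) = taylorSeries D Φ a * taylorSeries D Φ b := by
  ext n
  induction n generalizing a b with
  | zero => simp [PowerSeries.coeff_mul, coeff_taylorSeries]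
  | succ n ih =>
    refine mul_right_cancel₀ (Nat.cast_add_one_ne_zero (R := K) n) ?_
    simp only [← PowerSeries.coeff_derivative, Derivation.leibniz, derivative_taylorSeries,
      smul_eq_mul, taylorSeries_add, map_add, ih]

/-- `taylorSeries` as an algebra homomorphism. -/
def taylorHom (D : Derivation ℚ A A) (Φ : A →ₐ[ℚ] K) : A →ₐ[ℚ] PowerSeries K :=
  (RingHom.mk' ⟨⟨taylorSeries D Φ, taylorSeries_one D Φ⟩, taylorSeries_mul D Φ⟩
    (taylorSeries_add D Φ)).toRatAlgHom

theorem coeff_taylorHom (D : Derivation ℚ A A) (Φ : A →ₐ[ℚ] K) (a : A) (n : ℕ) :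
    coeff n (taylorHom D Φ a) = Φ (D^[n] a) / (n ! : K) :=
  coeff_taylorSeries D Φ a n

theorem derivative_taylorHom (D : Derivation ℚ A A) (Φ : A →ₐ[ℚ] K) (a : A) :
    PowerSeries.derivative K (taylorHom D Φ a) = taylorHom D Φ (D a) :=
  derivative_taylorSeries D Φ a

end Taylor

theorem eulerDeriv_expand {R : Type*} [CommRing R] {p : ℕ} (hp : p ≠ 0) (f : PowerSeries R) :
    eulerDeriv (PowerSeries.expand p hp f) = p • PowerSeries.expand p hp (eulerDeriv f) := by
  ext k
  rw [coeff_eulerDeriv, map_nsmul]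
  by_cases hk : p ∣ k
  · obtain ⟨j, rfl⟩ := hk
    rw [PowerSeries.coeff_expand_mul, PowerSeries.coeff_expand_mul, coeff_eulerDeriv,
      Nat.cast_mul, nsmul_eq_mul, mul_assoc]
  · rw [PowerSeries.coeff_expand_of_not_dvd _ _ _ hk, PowerSeries.coeff_expand_of_not_dvd _ _ _ hk,
      mul_zero, smul_zero]

/-! ### The formal solution -/

/-- Evaluation of differential polynomials along the base solution moved by `flow d`. The factor
`4 ^ d / (2 * d + 1)` rescales the time to match the normalization of the hierarchy. -/
def flowedBase (d : ℕ) : DiffPoly →ₐ[ℚ] PowerSeries ℂ :=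
  taylorHom ((4 ^ d / (2 * d + 1) : ℚ) • flow d) ((Algebra.ofId ℚ ℂ).comp evalBase)

theorem coeff_flowedBase (d n : ℕ) (a : DiffPoly) : coeff n (flowedBase d a) =
    ((((4 ^ d / (2 * d + 1)) ^ n * evalBase ((flow d)^[n] a) / n ! : ℚ)) : ℂ) := by
  have iterate_smul (c : ℚ) : (c • flow d)^[n] a = c ^ n • (flow d)^[n] a := by
    induction n with
    | zero => simp
    | succ n ih =>
      rw [Function.iterate_succ_apply', Function.iterate_succ_apply', ih, Derivation.smul_apply,
        Derivation.map_smul, smul_smul, pow_succ']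
  rw [flowedBase, coeff_taylorHom, iterate_smul, AlgHom.comp_apply, map_smul, smul_eq_mul,
    Algebra.ofId_apply, eq_ratCast]
  push_cast
  rfl

theorem eulerDeriv_flowedBase (d : ℕ) (a : DiffPoly) :
    (2 * d + 1) • eulerDeriv (flowedBase d a) =
      (4 ^ d : ℚ) • (PowerSeries.X * flowedBase d (flow d a)) := by
  have hd : (2 * d + 1 : ℚ) ≠ 0 := by positivity
  rw [eulerDeriv_apply, flowedBase, derivative_taylorHom, Derivation.smul_apply, map_smul,
    mul_smul_comm, ← Nat.cast_smul_eq_nsmul ℚ, smul_smul]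
  push_cast
  rw [mul_div_cancel₀ _ hd]

theorem iterate_flow_mem_weightSpace {a : DiffPoly} {w : ℚ} (ha : a ∈ weightSpace w) (d n : ℕ) :
    (flow d)^[n] a ∈ weightSpace (w + (2 * d + 1) * n) := by
  induction n with
  | zero => simpa using ha
  | succ n ih =>
    rw [Function.iterate_succ_apply', Nat.cast_succ, mul_add_one, ← add_assoc]
    exact flow_mem_weightSpace ih d

theorem flowedBase_del (d : ℕ) {a : DiffPoly} {w : ℚ} (ha : a ∈ weightSpace w) :
    flowedBase d (del a) = w • flowedBase d a + (2 * d + 1) • eulerDeriv (flowedBase d a) := by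
  ext n
  have iterate_flow_del : (flow d)^[n] (del a) = del ((flow d)^[n] a) :=
    Function.Commute.iterate_left (flow_del d) n a
  rw [map_add, PowerSeries.coeff_smul, map_nsmul, coeff_eulerDeriv, coeff_flowedBase,
    coeff_flowedBase, iterate_flow_del,
    evalBase_del_of_mem_weightSpace (iterate_flow_mem_weightSpace ha d n), Rat.smul_def]
  push_cast
  rw [nsmul_eq_mul]
  push_cast
  ring

/-- `flowedBase`, as a power series in `w` with time `w ^ (2 * d + 1)`. -/
def solutionHom (d : ℕ) : DiffPoly →ₐ[ℚ] PowerSeries ℂ :=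
  ((PowerSeries.expand (2 * d + 1) (Nat.succ_ne_zero _)).restrictScalars ℚ).comp (flowedBase d)

theorem solutionHom_apply (d : ℕ) (a : DiffPoly) : solutionHom d a =
    PowerSeries.expand (2 * d + 1) (Nat.succ_ne_zero _) (flowedBase d a) :=
  rfl

theorem eulerDeriv_solutionHom (d : ℕ) (a : DiffPoly) :
    eulerDeriv (solutionHom d a) =
      (4 ^ d : ℚ) • (PowerSeries.X ^ (2 * d + 1) * solutionHom d (flow d a)) := by
  rw [solutionHom_apply, eulerDeriv_expand, ← map_nsmul, eulerDeriv_flowedBase,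
    map_rat_smul, map_mul, PowerSeries.expand_X, solutionHom_apply]

theorem solutionHom_del (d : ℕ) {a : DiffPoly} {w : ℚ} (ha : a ∈ weightSpace w) :
    solutionHom d (del a) = w • solutionHom d a + eulerDeriv (solutionHom d a) := by
  rw [solutionHom_apply, flowedBase_del d ha, solutionHom_apply, eulerDeriv_expand, map_add,
    map_nsmul, map_rat_smul]

theorem xDeriv_neg_X_pow_mul_solutionHom (d : ℕ) {a : DiffPoly} {W : ℕ}
    (ha : a ∈ weightSpace W) :
    xDeriv ((-PowerSeries.X) ^ W * solutionHom d a) =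
      (-PowerSeries.X) ^ (W + 1) * solutionHom d (del a) := by
  rw [solutionHom_del d ha, xDeriv_apply, eulerDeriv_neg_X_pow_mul, Nat.cast_smul_eq_nsmul,
    ← mul_assoc, ← neg_mul, ← neg_mul, ← pow_succ']

/-- Evaluation along half the formal solution: the potential is `u = Y / 2` and `∂` becomes
`d/dX`. -/
def evalSolution (d : ℕ) : DiffPoly →ₐ[ℚ] PowerSeries ℂ :=
  MvPolynomial.aeval fun i => (-PowerSeries.X) ^ (i + 2) * solutionHom d (X i)

theorem evalSolution_of_mem_weightSpace (d : ℕ) {a : DiffPoly} {W : ℕ} (ha : a ∈ weightSpace W) :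
    evalSolution d a = (-PowerSeries.X) ^ W * solutionHom d a := by
  rw [evalSolution, aeval_pow_mul_of_mem_weightSpace ha, ← MvPolynomial.comp_aeval_apply,
    MvPolynomial.aeval_X_left_apply]

theorem evalSolution_del (d : ℕ) (a : DiffPoly) :
    evalSolution d (del a) = xDeriv (evalSolution d a) := by
  refine map_derivation_eq_derivation_map_of_X (E := (xDeriv (R := ℂ)).restrictScalars ℚ)
    (fun i => ?_) a
  rw [Derivation.restrictScalars_apply, evalSolution, del_X, MvPolynomial.aeval_X,
    MvPolynomial.aeval_X, ← del_X]
  exact (xDeriv_neg_X_pow_mul_solutionHom d (by exact_mod_cast X_mem_weightSpace i)).symm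

/-- The coefficients of the formal solution. -/
def formalSolutionCoeff (d n : ℕ) : ℂ := 2 * coeff n (flowedBase d (X 0))

theorem evalSolution_X_zero (d : ℕ) :
    evalSolution d (X 0) = (-PowerSeries.X) ^ 2 * solutionHom d (X 0) :=
  MvPolynomial.aeval_X _ _

theorem ansatzSeries_formalSolutionCoeff (d : ℕ) :
    ansatzSeries d (formalSolutionCoeff d) = (2 : ℂ) • evalSolution d (X 0) := by
  ext k
  rw [evalSolution_X_zero, neg_sq, PowerSeries.coeff_smul, PowerSeries.coeff_X_pow_mul',
    solutionHom_apply, PowerSeries.coeff_expand, ansatzSeries, PowerSeries.coeff_mk, ite_and]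
  split_ifs <;> simp [formalSolutionCoeff]

theorem half_smul_iterate_xDeriv_ansatzSeries (d i : ℕ) :
    (1 / 2 : ℂ) • xDeriv^[i] (ansatzSeries d (formalSolutionCoeff d)) = evalSolution d (X i) := by
  induction i with
  | zero =>
    rw [Function.iterate_zero_apply, ansatzSeries_formalSolutionCoeff, smul_smul]
    norm_num
  | succ i ih =>
    rw [Function.iterate_succ_apply', ← Derivation.map_smul, ih, ← evalSolution_del, del_X]

theorem doubleFactorial_smul_xDeriv_evalSolution_m (d : ℕ) :
    ((2 * d + 1)‼ : ℂ) • xDeriv (evalSolution d (m d)) =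
      -(PowerSeries.X ^ (2 * d + 3) * solutionHom d (flow d (X 0))) := by
  have hfact : ((2 * d + 1)‼ : ℚ) ≠ 0 := Nat.cast_ne_zero.2 (Nat.doubleFactorial_pos _).ne'
  have smul_del_m : ((2 * d + 1)‼ : ℚ) • del (m d) = flow d (X 0) := by
    rw [m, Derivation.map_smul, smul_smul, mul_one_div_cancel hfact, one_smul, flow_X_zero]
    rfl
  have hmem : flow d (X 0) ∈ weightSpace ((2 * d + 3 : ℕ) : ℚ) := by
    convert flow_mem_weightSpace (X_mem_weightSpace 0) d using 2
    push_cast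
    ring
  rw [← evalSolution_del, ← Rat.cast_natCast, Rat.cast_smul_eq_qsmul, ← map_smul, smul_del_m,
    evalSolution_of_mem_weightSpace d hmem, Odd.neg_pow ⟨d + 1, by ring⟩, neg_mul]

theorem eulerDeriv_sub_two_smul_ansatzSeries (d : ℕ) :
    eulerDeriv (ansatzSeries d (formalSolutionCoeff d)) -
        (2 : ℂ) • ansatzSeries d (formalSolutionCoeff d) =
      (2 ^ (2 * d + 1) : ℂ) • (PowerSeries.X ^ (2 * d + 3) * solutionHom d (flow d (X 0))) := by
  have two_smul_pow : (2 : ℂ) * ((4 ^ d : ℚ) : ℂ) = 2 ^ (2 * d + 1) := by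
    push_cast
    rw [pow_succ', pow_mul, show (2 : ℂ) ^ 2 = 4 by norm_num]
  rw [ansatzSeries_formalSolutionCoeff, evalSolution_X_zero, Derivation.map_smul, ← smul_sub,
    eulerDeriv_neg_X_pow_mul, mul_add, mul_smul_comm, ← ofNat_smul_eq_nsmul ℂ 2,
    add_sub_cancel_left, eulerDeriv_solutionHom, mul_smul_comm, ← mul_assoc, neg_sq, ← pow_add,
    ← Rat.cast_smul_eq_qsmul ℂ, smul_smul, two_smul_pow, add_comm 2]

theorem isFormalSolution_formalSolutionCoeff (d : ℕ) :
    IsFormalSolution d (formalSolutionCoeff d) := by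
  refine (isFormalSolution_iff d _).2 ⟨?_, ?_⟩
  · norm_num [formalSolutionCoeff, coeff_flowedBase]
  · simp only [seriesP34, half_smul_iterate_xDeriv_ansatzSeries]
    rw [← Function.comp_def (evalSolution d) X, ← MvPolynomial.aeval_unique, mul_smul,
      doubleFactorial_smul_xDeriv_evalSolution_m, add_sub_assoc,
      eulerDeriv_sub_two_smul_ansatzSeries, smul_neg, neg_add_cancel]

/-! ### Asymptotics of the coefficients -/

theorem flows_replicate (d n : ℕ) (a : DiffPoly) :
    flows (Multiset.replicate n d) a = (flow d)^[n] a := by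
  induction n with
  | zero => rfl
  | succ n ih => rw [Multiset.replicate_succ, iterDeriv_cons, Function.iterate_succ_apply', ← ih]

theorem flowWeight_replicate (d n : ℕ) :
    flowWeight (Multiset.replicate n d) = (2 * d + 1) * n := by
  rw [flowWeight_eq, Multiset.sum_replicate, Multiset.card_replicate, smul_eq_mul]
  ring

theorem evalBase_iterate_flow_X_zero {d n : ℕ} (hn : n ≠ 0) :
    evalBase ((flow d)^[n] (X 0)) =
      (2 * d + 1) * n * ((2 * d + 1) * n + 1) * bgwNumber (Multiset.replicate n d) := by
  rw [bgwNumber, flows_replicate, flowWeight_replicate]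
  push_cast
  field_simp

theorem formalSolutionCoeff_eq (d : ℕ) {n : ℕ} (hn : n ≠ 0) :
    formalSolutionCoeff d n = (normalizedNumber (Multiset.replicate n d) / 2 : ℝ) *
      ((((2 * d + 1) * n + 1)! : ℂ) / ((2 * (d : ℂ) + 1) ^ n * (n ! : ℂ))) := by
  obtain ⟨w, hw⟩ : ∃ w, (2 * d + 1) * n = w + 1 := Nat.exists_eq_succ_of_ne_zero (by positivity)
  have hwC : (2 * d + 1 : ℂ) * n = w + 1 := by exact_mod_cast hw
  have hbgw : (bgwNumber (Multiset.replicate n d) : ℂ) =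
      w ! / 4 ^ (n * d + 1) * normalizedNumber (Multiset.replicate n d) := by
    rw [← Complex.ofReal_ratCast, cast_bgwNumber_eq (Multiset.sum_replicate n d)
      ((flowWeight_replicate d n).trans hw)]
    push_cast
    rw [smul_eq_mul]
  have h4 : (4 : ℂ) ^ (n * d + 1) = (4 ^ d) ^ n * 4 := by rw [pow_succ, mul_comm n, pow_mul]
  rw [formalSolutionCoeff, coeff_flowedBase, evalBase_iterate_flow_X_zero hn, hw]
  push_cast
  rw [hwC, hbgw, h4, div_pow, Nat.factorial_succ, Nat.factorial_succ]
  push_cast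
  field_simp
  ring

theorem isEquivalent_formalSolutionCoeff {d : ℕ} (hd : 1 ≤ d) :
    formalSolutionCoeff d ~[atTop] fun n : ℕ => (1 / (Real.pi : ℂ)) *
      ((((2 * d + 1) * n + 1)! : ℂ) / ((2 * (d : ℂ) + 1) ^ n * (n ! : ℂ))) := by
  have h_factor : (fun n => ((normalizedNumber (Multiset.replicate n d) / 2 : ℝ) : ℂ)) ~[atTop]
      fun _ => 1 / (Real.pi : ℂ) := by
    refine (isEquivalent_const_iff_tendsto (by simp [Real.pi_ne_zero])).2 ?_
    have h_limit : ((2 / Real.pi / 2 : ℝ) : ℂ) = 1 / (Real.pi : ℂ) := by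
      push_cast
      field_simp
    exact h_limit ▸ ((tendsto_normalizedNumber_replicate hd).div_const 2).ofReal
  refine (h_factor.mul (IsEquivalent.refl (u := fun n : ℕ => (((2 * d + 1) * n + 1)! : ℂ) /
    ((2 * (d : ℂ) + 1) ^ n * (n ! : ℂ))))).congr_left ?_
  filter_upwards [eventually_ne_atTop 0] with n hn
  exact (formalSolutionCoeff_eq d hn).symm

end PainleveXXXIV

end

theorem theorem9p3 (d : ℕ) (hd : 1 ≤ d) :
    (∃! y : ℕ → ℂ, PainleveXXXIV.IsFormalSolution d y) ∧
      ∀ y : ℕ → ℂ, PainleveXXXIV.IsFormalSolution d y →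
        y ~[atTop] fun n : ℕ =>
          (1 / (Real.pi : ℂ)) *
            ((((2 * d + 1) * n + 1)! : ℂ) / ((2 * (d : ℂ) + 1) ^ n * (n ! : ℂ))) := by
  have hs := PainleveXXXIV.isFormalSolution_formalSolutionCoeff d
  refine ⟨⟨_, hs, fun y hy => PainleveXXXIV.isFormalSolution_unique hy hs⟩, fun y hy => ?_⟩
  rw [PainleveXXXIV.isFormalSolution_unique hy hs]
  exact PainleveXXXIV.isEquivalent_formalSolutionCoeff hd
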